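/- **Theorem 4.1.** All $\lambda$-rings are "special": a $\lambda$-ring is a commutative unital ring $R$ with functions $\lambda^i\colon R\to R$ ($i\ge 0$) such that $\lambda^0(r)=1$, $\lambda^1(r)=r$, $\lambda^i(1)=0$ for $i>1$, $\lambda^i(r+s)=\sum_{k=0}^i\lambda^k(r)\lambda^{i-k}(s)$, $\lambda^i(rs)=P_i(\lambda^1(r),\dots,\lambda^i(r);\lambda^1(s),\dots,\lambda^i(s))$ and $\lambda^i(\lambda^j(r))=P_{i,j}(\lambda^1(r),\dots,\lambda^{ij}(r))$. Here $P_i$ and $P_{i,j}$ are the integral polynomials for which $P_i$, evaluated at the elementary symmetric functions of $\xi_1,\dots,\xi_i$ and of $\eta_1,\dots,\eta_i$, is the coefficient of $t^i$ in $\prod_{m,n=1}^i(1+\xi_m\eta_nt)$, and $P_{i,j}$, evaluated at the elementary symmetric functions of $\xi_1,\dots,\xi_{ij}$, is the coefficient of $t^i$ in $\prod_{l_1<\dots<l_j}(1+\xi_{l_1}\cdots\xi_{l_j}t)$. The Adams operations $\psi^n$ ($n\ge1$) are defined by $\psi^n(r)-\lambda^1(r)\psi^{n-1}(r)+\dots+(-1)^{n-1}\lambda^{n-1}(r)\psi^1(r)+(-1)^n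 n\lambda^n(r)=0$. A filtered $\lambda$-ring is a $\lambda$-ring with a decreasing sequence of ideals $I^n$ such that $\lambda^i(I^n)\subseteq I^n$ for all $n$ and all $i>0$. Let $\overline{\mathrm{End}}(R)$ be the algebra (under composition) of those $\mathbb Z$-linear $f\colon R\to R$ with $f(r)^p\equiv f(r^p)\pmod{pR}$ for all primes $p$ and all $r\in R$, and let $$H_\lambda^0(R)=\ker d^0\subseteq\overline{\mathrm{End}}(R),\qquad (d^0f)(m)=\psi^m f-f\psi^m\quad(m\ge1).$$ Let $R$ be a filtered $\lambda$-ring structure on $\mathbb Z[x]/(x^3)$, with $x\in I^d$ for some $d>0$. Write $\mathbb Z$-linear self maps of $R$ as matrices in $M(3,\mathbb Z)$ with respect to the basis $1,x,x^2$ (the columns are the coordinates of the images of the basis elements). Write * $R=S((c_p))$, for integers $c_p$ indexed by the primes $p$, if $\psi^p(x)=c_px^2$ for all primes $p$; * $R=S((b_p),h)$, for integers $b_p$ indexed by the primes $p$ and an integer $h$, if $b_2\ne0$ and $\psi^p(x)=b_px+h\,\frac{b_p(b_p-1)}{G}\,x^2$ for all primes $p$, where $G=\gcd\{b_q(b_q-1):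 q\text{ prime}\}$. Then $R=S((c_p))$ for some $(c_p)$, or $R=S((b_p),h)$ for some $(b_p)$ and some odd $h$. Moreover: 1. If $R=S((c_p))$, then, as a subalgebra of $M(3,\mathbb Z)$, $$H_\lambda^0(R)=\left\{\begin{bmatrix}a&0&0\\0&j&0\\0&k&j\end{bmatrix}: a,j,k\in\mathbb Z\right\}.$$ 2. If $R=S((b_p),h)$, then, as a subalgebra of $M(3,\mathbb Z)$, $$H_\lambda^0(R)=\left\{\begin{bmatrix}a&0&0\\0&j&0\\0&k&t\end{bmatrix}: a,j,k,t\in\mathbb Z,\ h(t-j)=kG\right\}.$$ In each case $H_\lambda^0(R)$ is commutative, and it is free of rank $3$ as an abelian group. -/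

import Mathlib

noncomputable section

namespace LambdaCohomology

/-! ### The universal polynomials -/

/-- `∏_{m,n=1}^{i} (1 + ξ_m η_n t)`, as a polynomial in `t` with coefficients in
`ℤ[ξ_1, …, ξ_i, η_1, …, η_i]`; the `ξ`'s are the left and the `η`'s the right variables. -/
def prodSeries (i : ℕ) : Polynomial (MvPolynomial (Fin i ⊕ Fin i) ℤ) :=
  ∏ m : Fin i, ∏ n : Fin i,
    (1 + Polynomial.C (MvPolynomial.X (Sum.inl m) * MvPolynomial.X (Sum.inr n)) * Polynomial.X)

/-- The `k`-th elementary symmetric function of the `ξ`'s. -/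
def esymmXi (i k : ℕ) : MvPolynomial (Fin i ⊕ Fin i) ℤ :=
  MvPolynomial.rename Sum.inl (MvPolynomial.esymm (Fin i) ℤ k)

/-- The `k`-th elementary symmetric function of the `η`'s. -/
def esymmEta (i k : ℕ) : MvPolynomial (Fin i ⊕ Fin i) ℤ :=
  MvPolynomial.rename Sum.inr (MvPolynomial.esymm (Fin i) ℤ k)

/-- `∏_{l_1 < ⋯ < l_j} (1 + ξ_{l_1} ⋯ ξ_{l_j} t)`, as a polynomial in `t` with coefficients in
`ℤ[ξ_1, …, ξ_{ij}]`. -/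
def compSeries (i j : ℕ) : Polynomial (MvPolynomial (Fin (i * j)) ℤ) :=
  ∏ S ∈ Finset.powersetCard j (Finset.univ : Finset (Fin (i * j))),
    (1 + Polynomial.C (∏ l ∈ S, MvPolynomial.X l) * Polynomial.X)

lemma exists_esymm_of_isSymmetric {R : Type*} [CommRing R] {n : ℕ} (F : MvPolynomial (Fin n) R)
    (hF : F.IsSymmetric) : ∃ Q : MvPolynomial (Fin n) R,
      MvPolynomial.aeval (fun k : Fin n => MvPolynomial.esymm (Fin n) R (k + 1)) Q = F := by
  obtain ⟨Q, hQ⟩ := MvPolynomial.esymmAlgHom_surjective (σ := Fin n) (n := n) R (by simp) ⟨F, hF⟩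
  refine ⟨Q, ?_⟩
  rw [← MvPolynomial.esymmAlgHom_apply, hQ]

lemma exists_compPoly (i j : ℕ) : ∃ P : MvPolynomial (Fin (i * j)) ℤ,
    MvPolynomial.aeval (fun k : Fin (i * j) => MvPolynomial.esymm (Fin (i * j)) ℤ (k + 1)) P
      = (compSeries i j).coeff i := by
  apply exists_esymm_of_isSymmetric
  intro e
  have h : (compSeries i j).map (MvPolynomial.rename (R := ℤ) e).toRingHom = compSeries i j := by
    unfold compSeries
    rw [Polynomial.map_prod]
    refine Finset.prod_bij' (fun S _ => S.map e.toEmbedding) (fun S _ => S.map e.symm.toEmbedding)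
      ?_ ?_ ?_ ?_ ?_
    · intro S hS
      simpa [Finset.mem_powersetCard] using hS
    · intro S hS
      simpa [Finset.mem_powersetCard] using hS
    · intro S _
      ext x; simp
    · intro S _
      ext x; simp
    · intro S _
      simp only [Polynomial.map_add, Polynomial.map_one, Polynomial.map_mul, Polynomial.map_X,
        Polynomial.map_C, Finset.prod_map]
      congr 3
      exact map_prod (MvPolynomial.rename (R := ℤ) e) _ _ |>.trans (by simp)
  conv_rhs => rw [← h]
  rw [Polynomial.coeff_map]
  rfl

lemma prodSeries_eq (i : ℕ) : prodSeries i = ∏ m : Fin i, ∑ k ∈ Finset.range (i + 1),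
    Polynomial.C (esymmEta i k * MvPolynomial.X (Sum.inl m) ^ k) * Polynomial.X ^ k := by
  unfold prodSeries
  refine Finset.prod_congr rfl fun m _ => ?_
  rw [Finset.prod_one_add, Finset.sum_powerset]
  simp only [Finset.card_univ, Fintype.card_fin]
  refine Finset.sum_congr rfl fun k _ => ?_
  unfold esymmEta MvPolynomial.esymm
  rw [map_sum, Finset.sum_mul, map_sum, Finset.sum_mul]
  refine Finset.sum_congr rfl fun S hS => ?_
  have hk : S.card = k := (Finset.mem_powersetCard.1 hS).2
  simp only [Finset.prod_mul_distrib, map_mul, Finset.prod_const, hk, map_prod,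
    MvPolynomial.rename_X, map_pow]
  ring

lemma exists_prodPoly (i : ℕ) : ∃ P : MvPolynomial (Fin i ⊕ Fin i) ℤ,
    MvPolynomial.aeval (Sum.elim (fun k : Fin i => esymmXi i (k + 1))
      (fun k : Fin i => esymmEta i (k + 1))) P = (prodSeries i).coeff i := by
  let s : ℕ → (MvPolynomial (Fin i) ℤ) := fun k => if h : 0 < k ∧ k - 1 < i then MvPolynomial.X ⟨k - 1, h.2⟩ else 1
  let G : Polynomial (MvPolynomial (Fin i) (MvPolynomial (Fin i) ℤ)) := ∏ m : Fin i, ∑ k ∈ Finset.range (i + 1),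
    Polynomial.C (MvPolynomial.C (s k) * MvPolynomial.X m ^ k) * Polynomial.X ^ k
  have hsym : (G.coeff i).IsSymmetric := by
    intro e
    have h : G.map (MvPolynomial.rename (R := (MvPolynomial (Fin i) ℤ)) e).toRingHom = G := by
      simp only [G, Polynomial.map_prod, Polynomial.map_sum, Polynomial.map_mul,
        Polynomial.map_pow, Polynomial.map_X, Polynomial.map_C]
      refine Fintype.prod_equiv e _ _ fun m => ?_
      simp
    conv_rhs => rw [← h]
    rw [Polynomial.coeff_map]
    rfl
  obtain ⟨Q, hQ⟩ := exists_esymm_of_isSymmetric _ hsym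
  let β : (MvPolynomial (Fin i) ℤ) →+* MvPolynomial (Fin i ⊕ Fin i) ℤ :=
    (MvPolynomial.aeval (fun k : Fin i => esymmEta i (k + 1))).toRingHom
  let φ : MvPolynomial (Fin i) (MvPolynomial (Fin i) ℤ) →+* MvPolynomial (Fin i ⊕ Fin i) ℤ :=
    MvPolynomial.eval₂Hom β (fun m => MvPolynomial.X (Sum.inl m))
  have hβ : ∀ k ∈ Finset.range (i + 1), β (s k) = esymmEta i k := by
    intro k hk
    rw [Finset.mem_range] at hk
    rcases Nat.eq_zero_or_pos k with rfl | h0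
    · simp [s, esymmEta]
    · have h : 0 < k ∧ k - 1 < i := by omega
      have h1 : k - 1 + 1 = k := by omega
      rw [show s k = MvPolynomial.X ⟨k - 1, h.2⟩ from dif_pos h]
      simp [β, h1]
  have hG : G.map φ = prodSeries i := by
    rw [prodSeries_eq]
    simp only [G, Polynomial.map_prod, Polynomial.map_sum, Polynomial.map_mul,
      Polynomial.map_pow, Polynomial.map_X, Polynomial.map_C]
    refine Finset.prod_congr rfl fun m _ => Finset.sum_congr rfl fun k hk => ?_
    rw [← hβ k hk]
    simp [φ]
  have hesymm : ∀ k, φ (MvPolynomial.esymm (Fin i) (MvPolynomial (Fin i) ℤ) k) = esymmXi i k := by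
    intro k
    simp [φ, MvPolynomial.esymm, esymmXi]
  refine ⟨(MvPolynomial.sumAlgEquiv ℤ (Fin i) (Fin i)).symm Q, ?_⟩
  rw [← hG, Polynomial.coeff_map, ← hQ]
  clear hQ hsym hG
  induction Q using MvPolynomial.induction_on with
  | C b =>
    have : φ (MvPolynomial.aeval (fun k : Fin i => MvPolynomial.esymm (Fin i) (MvPolynomial (Fin i) ℤ) (k + 1))
        (MvPolynomial.C b)) = β b := by simp [φ]
    rw [this]
    induction b using MvPolynomial.induction_on with
    | C a => simp [β]
    | add p q hp hq =>
      simp only [map_add] at hp hq ⊢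
      rw [hp (by simp [φ]), hq (by simp [φ])]
    | mul_X p k hp =>
      simp only [map_mul] at hp ⊢
      rw [hp (by simp [φ])]
      simp [β]
  | add p q hp hq => simp only [map_add, hp, hq]
  | mul_X p k hp =>
    simp only [map_mul, hp]
    simp [hesymm]

/-- The universal polynomial `P_i` in `2i` variables, determined by: `P_i(s_1, …, s_i; σ_1, …, σ_i)`
is the coefficient of `t^i` in `∏_{m,n=1}^{i} (1 + ξ_m η_n t)`, where the `s`'s and `σ`'s are the
elementary symmetric functions of the `ξ`'s and the `η`'s. -/
def prodPoly (i : ℕ) : MvPolynomial (Fin i ⊕ Fin i) ℤ := (exists_prodPoly i).choose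

lemma prodPoly_spec (i : ℕ) :
    MvPolynomial.aeval (Sum.elim (fun k : Fin i => esymmXi i (k + 1))
      (fun k : Fin i => esymmEta i (k + 1))) (prodPoly i) = (prodSeries i).coeff i :=
  (exists_prodPoly i).choose_spec

/-- The universal polynomial `P_{i,j}` in `ij` variables, determined by: `P_{i,j}(s_1, …, s_{ij})`
is the coefficient of `t^i` in `∏_{l_1 < ⋯ < l_j} (1 + ξ_{l_1} ⋯ ξ_{l_j} t)`. -/
def compPoly (i j : ℕ) : MvPolynomial (Fin (i * j)) ℤ := (exists_compPoly i j).choose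

lemma compPoly_spec (i j : ℕ) :
    MvPolynomial.aeval (fun k : Fin (i * j) => MvPolynomial.esymm (Fin (i * j)) ℤ (k + 1))
      (compPoly i j) = (compSeries i j).coeff i :=
  (exists_compPoly i j).choose_spec

/-! ### λ-rings and Adams operations -/

/-- A λ-ring structure (a "special" λ-ring structure in the older terminology) on `R`. -/
structure LambdaRing (R : Type*) [CommRing R] where
  lam : ℕ → R → R
  lam_zero : ∀ r, lam 0 r = 1
  lam_one : ∀ r, lam 1 r = r
  lam_of_one : ∀ i, 1 < i → lam i 1 = 0
  lam_add : ∀ i r s, lam i (r + s) = ∑ k ∈ Finset.range (i + 1), lam k r * lam (i - k) s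
  lam_mul : ∀ i r s, lam i (r * s) =
    MvPolynomial.aeval (Sum.elim (fun k : Fin i => lam (k + 1) r) (fun k : Fin i => lam (k + 1) s))
      (prodPoly i)
  lam_lam : ∀ i j r, lam i (lam j r) =
    MvPolynomial.aeval (fun k : Fin (i * j) => lam (k + 1) r) (compPoly i j)

/-- A filtered λ-ring structure on `R`: a decreasing sequence of ideals, closed under the
operations `λ^i`, `i > 0`. -/
structure FilteredLambdaRing (R : Type*) [CommRing R] extends LambdaRing R where
  I : ℕ → Ideal R
  antitone_I : Antitone I
  lam_mem : ∀ n i, 0 < i → ∀ r ∈ I n, lam i r ∈ I n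

namespace LambdaRing

variable {R : Type*} [CommRing R] (L : LambdaRing R)

/-- The Adams operations `ψ^n`, `n ≥ 1`, as functions, defined inductively by the Newton formula
(see `newton`). The value at `n = 0` is `0`; it is a convention that makes the recursion uniform. -/
def adamsFun (L : LambdaRing R) (r : R) : ℕ → R
  | n => (∑ k : Fin n, (-1) ^ (n - k + 1) * L.lam (n - k) r * adamsFun L r k)
      + (-1) ^ (n + 1) * n * L.lam n r

lemma adamsFun_eq (r : R) (n : ℕ) : L.adamsFun r n =
    (∑ k ∈ Finset.range n, (-1) ^ (n - k + 1) * L.lam (n - k) r * L.adamsFun r k)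
      + (-1) ^ (n + 1) * n * L.lam n r := by
  rw [adamsFun, Finset.sum_range]

lemma adamsFun_zero (r : R) : L.adamsFun r 0 = 0 := by
  rw [adamsFun_eq]; simp

/-- The Newton formula
`ψ^n(r) - λ^1(r) ψ^{n-1}(r) + ⋯ + (-1)^{n-1} λ^{n-1}(r) ψ^1(r) + (-1)^n n λ^n(r) = 0`. -/
lemma newton (r : R) (n : ℕ) (hn : 0 < n) :
    (∑ i ∈ Finset.range n, (-1) ^ i * L.lam i r * L.adamsFun r (n - i))
      + (-1) ^ n * n * L.lam n r = 0 := by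
  have h : ∑ i ∈ Finset.range (n + 1), (-1) ^ i * L.lam i r * L.adamsFun r (n - i)
      + (-1) ^ n * n * L.lam n r = 0 := by
    rw [← Finset.sum_range_reflect, Finset.sum_range_succ]
    have h1 : n + 1 - 1 - n = 0 := by omega
    have h2 : n - (n + 1 - 1 - n) = n := by omega
    rw [h2, h1, adamsFun_eq, pow_zero, lam_zero, one_mul, one_mul, ← add_assoc,
      ← Finset.sum_add_distrib, Finset.sum_eq_zero, pow_succ]
    · ring
    · intro k hk
      rw [Finset.mem_range] at hk
      have h3 : n + 1 - 1 - k = n - k := by omega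
      have h4 : n - (n - k) = k := by omega
      rw [h3, h4, pow_succ]
      ring
  rw [Finset.sum_range_succ, Nat.sub_self, adamsFun_zero] at h
  simpa using h

/-- Generating function of the `λ^i(r)`. -/
def lamSeries (r : R) : PowerSeries R := PowerSeries.mk fun n => L.lam n r

/-- Generating function of the `(-1)^{n+1} ψ^n(r)`. -/
def adamsSeries (r : R) : PowerSeries R := PowerSeries.mk fun n => (-1) ^ (n + 1) * L.adamsFun r n

lemma isUnit_lamSeries (r : R) : IsUnit (L.lamSeries r) := by
  rw [PowerSeries.isUnit_iff_constantCoeff]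
  simp [lamSeries, ← PowerSeries.coeff_zero_eq_constantCoeff_apply, lam_zero]

lemma adamsSeries_mul_lamSeries (r : R) : L.adamsSeries r * L.lamSeries r
    = PowerSeries.X * PowerSeries.derivative R (L.lamSeries r) := by
  ext n
  have e : PowerSeries.coeff n (PowerSeries.X * PowerSeries.derivative R (L.lamSeries r))
      = n * L.lam n r := by
    cases n with
    | zero => simp
    | succ n =>
      rw [PowerSeries.coeff_succ_X_mul, PowerSeries.coeff_derivative]
      simp [lamSeries, mul_comm]
  rw [e, PowerSeries.coeff_mul, Finset.Nat.sum_antidiagonal_eq_sum_range_succ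
    (fun a b => PowerSeries.coeff a (L.adamsSeries r) * PowerSeries.coeff b (L.lamSeries r)),
    Finset.sum_range_succ]
  simp only [adamsSeries, lamSeries, PowerSeries.coeff_mk, Nat.sub_self, lam_zero, mul_one]
  conv_lhs => arg 2; rw [adamsFun_eq]
  rw [mul_add, Finset.mul_sum, ← add_assoc, ← Finset.sum_add_distrib, Finset.sum_eq_zero, zero_add]
  · rw [← mul_assoc, ← mul_assoc, ← pow_add, Even.neg_one_pow ⟨n + 1, rfl⟩, one_mul]
  · intro k hk
    rw [Finset.mem_range] at hk
    obtain ⟨m, rfl⟩ := Nat.exists_eq_add_of_lt hk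
    have h : k + m + 1 - k = m + 1 := by omega
    rw [h]
    have h2 : ((-1 : R) ^ m) * (-1) ^ m = 1 := by rw [← pow_add, Even.neg_one_pow ⟨m, rfl⟩]
    linear_combination ((-1) ^ k * L.lam (m + 1) r * L.adamsFun r k) * h2

lemma adamsFun_add (r s : R) (n : ℕ) :
    L.adamsFun (r + s) n = L.adamsFun r n + L.adamsFun s n := by
  have hl : L.lamSeries (r + s) = L.lamSeries r * L.lamSeries s := by
    ext n
    rw [PowerSeries.coeff_mul, Finset.Nat.sum_antidiagonal_eq_sum_range_succ
      (fun a b => PowerSeries.coeff a (L.lamSeries r) * PowerSeries.coeff b (L.lamSeries s))]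
    simp [lamSeries, lam_add]
  have h : L.adamsSeries (r + s) = L.adamsSeries r + L.adamsSeries s := by
    apply (L.isUnit_lamSeries (r + s)).mul_right_cancel
    rw [adamsSeries_mul_lamSeries, hl, Derivation.leibniz, smul_eq_mul, smul_eq_mul]
    linear_combination (-L.lamSeries s) * L.adamsSeries_mul_lamSeries r
      - L.lamSeries r * L.adamsSeries_mul_lamSeries s
  have h2 := congrArg (PowerSeries.coeff n) h
  simp only [adamsSeries, PowerSeries.coeff_mk, map_add, ← mul_add] at h2
  exact ((isUnit_one.neg).pow (n + 1)).mul_left_cancel h2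

/-- The Adams operation `ψ^n`, `n ≥ 1`, as an element of `End(R)`. -/
def adams (n : ℕ+) : Module.End ℤ R :=
  (AddMonoidHom.mk' (fun r => L.adamsFun r n) fun r s => L.adamsFun_add r s n).toIntLinearMap

lemma adams_apply (n : ℕ+) (r : R) : L.adams n r = L.adamsFun r n := rfl

end LambdaRing

/-! ### The algebra `H_λ^0(R)` -/

lemma dvd_add_pow_sub {R : Type*} [CommRing R] {p : ℕ} (hp : p.Prime) (a b : R) :
    (p : R) ∣ (a + b) ^ p - (a ^ p + b ^ p) := by
  obtain ⟨c, hc⟩ := exists_add_pow_prime_eq hp a b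
  exact ⟨a * b * c, by rw [hc]; ring⟩

/-- The algebra `\overline{End}(R)` of those `ℤ`-linear endomorphisms `f` of `R` with
`f(r)^p ≡ f(r^p) (mod pR)` for all primes `p` and all `r`. Multiplication is composition. -/
def Endbar (R : Type*) [CommRing R] : Subalgebra ℤ (Module.End ℤ R) where
  carrier := {f | ∀ p : ℕ, p.Prime → ∀ r : R, (p : R) ∣ f r ^ p - f (r ^ p)}
  mul_mem' := by
    intro f g hf hg p hp r
    obtain ⟨c, hc⟩ := hg p hp r
    obtain ⟨d, hd⟩ := hf p hp (g r)
    refine ⟨d + f c, ?_⟩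
    have h1 : g r ^ p = g (r ^ p) + (p : ℤ) • c := by
      rw [zsmul_eq_mul, Int.cast_natCast, ← hc]; ring
    have h2 : f (g r ^ p) = f (g (r ^ p)) + (p : R) * f c := by
      rw [h1, map_add, map_zsmul, zsmul_eq_mul, Int.cast_natCast]
    simp only [Module.End.mul_apply]
    linear_combination hd + h2
  add_mem' := by
    intro f g hf hg p hp r
    have h := dvd_add (dvd_add_pow_sub hp (f r) (g r)) (dvd_add (hf p hp r) (hg p hp r))
    simp only [LinearMap.add_apply]
    convert h using 1
    ring
  algebraMap_mem' := by
    intro n p hp r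
    have h : (p : ℤ) ∣ n ^ p - n := by
      have := Fact.mk hp
      rw [← ZMod.intCast_zmod_eq_zero_iff_dvd]
      simp
    have h' : (p : R) ∣ (n : R) ^ p - n := by
      obtain ⟨c, hc⟩ := h
      exact ⟨c, by exact_mod_cast congrArg (Int.cast : ℤ → R) hc⟩
    have : (algebraMap ℤ (Module.End ℤ R) n) r ^ p - (algebraMap ℤ (Module.End ℤ R) n) (r ^ p)
        = ((n : R) ^ p - n) * r ^ p := by
      simp only [Module.algebraMap_end_apply, zsmul_eq_mul]
      ring
    rw [this]
    exact Dvd.dvd.mul_right h' _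

namespace LambdaRing

variable {R : Type*} [CommRing R] (L : LambdaRing R)

/-- The formula `(d^0 f)(m) = ψ^m f - f ψ^m` for the differential of the cochain complex
`F^0 → F^1 → ⋯`, where `F^0 = \overline{End}(R)` and `F^1` consists of functions from the positive
integers to `End(R)`. -/
def d0 (f : Module.End ℤ R) : ℕ+ → Module.End ℤ R :=
  fun m => L.adams m * f - f * L.adams m

/-- `H_λ^0(R)`, the kernel of `d^0` on `F^0 = \overline{End}(R)`, with the composition product. -/
def H0 : Subalgebra ℤ (Module.End ℤ R) where
  carrier := {f | f ∈ Endbar R ∧ L.d0 f = 0}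
  mul_mem' := by
    rintro f g ⟨hf, hf'⟩ ⟨hg, hg'⟩
    refine ⟨mul_mem hf hg, funext fun m => ?_⟩
    have h1 : L.adams m * f = f * L.adams m := sub_eq_zero.1 (congrFun hf' m)
    have h2 : L.adams m * g = g * L.adams m := sub_eq_zero.1 (congrFun hg' m)
    change L.adams m * (f * g) - f * g * L.adams m = 0
    rw [← mul_assoc, h1, mul_assoc, h2, ← mul_assoc, sub_self]
  add_mem' := by
    rintro f g ⟨hf, hf'⟩ ⟨hg, hg'⟩
    refine ⟨add_mem hf hg, funext fun m => ?_⟩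
    have h1 : L.adams m * f = f * L.adams m := sub_eq_zero.1 (congrFun hf' m)
    have h2 : L.adams m * g = g * L.adams m := sub_eq_zero.1 (congrFun hg' m)
    change L.adams m * (f + g) - (f + g) * L.adams m = 0
    rw [mul_add, add_mul, h1, h2, sub_self]
  algebraMap_mem' := fun n =>
    ⟨(Endbar R).algebraMap_mem n, funext fun m => sub_eq_zero.2 (Algebra.commutes n _).symm⟩

end LambdaRing

/-! ### The truncated polynomial ring `ℤ[x]/(x^3)` -/

/-- `ℤ[x]/(x^3)`. -/
abbrev Trunc3 : Type := AdjoinRoot ((Polynomial.X : Polynomial ℤ) ^ 3)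

/-- The class of `x` in `ℤ[x]/(x^3)`. -/
def x3 : Trunc3 := AdjoinRoot.root ((Polynomial.X : Polynomial ℤ) ^ 3)

/-- The `ℤ`-basis `1, x, x^2` of `ℤ[x]/(x^3)`. -/
def basis3 : Module.Basis (Fin 3) ℤ Trunc3 :=
  (AdjoinRoot.powerBasis' (Polynomial.monic_X_pow 3)).basis.reindex
    (finCongr (by rw [AdjoinRoot.powerBasis'_dim, Polynomial.natDegree_X_pow]))

lemma basis3_apply (i : Fin 3) : basis3 i = x3 ^ (i : ℕ) := by
  simp [basis3, x3]

/-- The matrix, with respect to `1, x, x^2`, of a `ℤ`-linear self map of `ℤ[x]/(x^3)`; the columns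
are the coordinates of the images of `1`, `x` and `x^2`. -/
def toMat : Module.End ℤ Trunc3 ≃ₐ[ℤ] Matrix (Fin 3) (Fin 3) ℤ :=
  LinearMap.toMatrixAlgEquiv basis3

/-- `H_λ^0(R)` as a subalgebra of `M(3, ℤ)`, for a λ-ring structure on `ℤ[x]/(x^3)`. -/
def H0Mat (L : LambdaRing Trunc3) : Subalgebra ℤ (Matrix (Fin 3) (Fin 3) ℤ) :=
  L.H0.map (toMat : Module.End ℤ Trunc3 →ₐ[ℤ] Matrix (Fin 3) (Fin 3) ℤ)

/-- The greatest common divisor (the non-negative generator of the generated ideal) of a possibly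
infinite family of integers. -/
def familyGcd {ι : Type*} (f : ι → ℤ) : ℕ :=
  (Submodule.IsPrincipal.generator (Ideal.span (Set.range f))).natAbs

lemma dvd_familyGcd_iff {ι : Type*} (f : ι → ℤ) (d : ℤ) :
    d ∣ (familyGcd f : ℤ) ↔ ∀ i, d ∣ f i := by
  rw [familyGcd, Int.dvd_natAbs, ← Ideal.mem_span_singleton,
    ← Ideal.span_singleton_le_iff_mem, Ideal.span_singleton_generator, Ideal.span_le]
  simp [Set.range_subset_iff, Ideal.mem_span_singleton]

/-- `G = gcd {b_q (b_q - 1) : q prime}`. -/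
def gcdG (b : Nat.Primes → ℤ) : ℕ := familyGcd fun q => b q * (b q - 1)

/-- A prime number as a positive integer. -/
def primeP (p : Nat.Primes) : ℕ+ := ⟨p, p.2.pos⟩

/-- `R = S((c_p))`: the Adams operations are given by `ψ^p(x) = c_p x^2` for all primes `p`. -/
def IsSc (L : LambdaRing Trunc3) (c : Nat.Primes → ℤ) : Prop :=
  ∀ p : Nat.Primes, L.adams (primeP p) x3 = c p • x3 ^ 2

/-- `R = S((b_p), h)`: `b_2 ≠ 0`, and the Adams operations are given by
`ψ^p(x) = b_p x + c_p x^2` with `c_p = h b_p (b_p - 1) / G` for all primes `p`. -/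
def IsSbh (L : LambdaRing Trunc3) (b : Nat.Primes → ℤ) (h : ℤ) : Prop :=
  b ⟨2, Nat.prime_two⟩ ≠ 0 ∧ ∀ p : Nat.Primes,
    L.adams (primeP p) x3 = b p • x3 + (h * (b p * (b p - 1) / (gcdG b : ℤ))) • x3 ^ 2

end LambdaCohomology

end

/-! For a torsion-free λ-ring, Newton's formula makes the Adams operations the power sums of the
sequence `λ^k(r)`, and `n! λ^n(r)` is a universal polynomial in them (`IsNewton.factorial_mul`). In
power sums the axioms for `λ^i(rs)` and `λ^i(λ^j(r))` become simple: the `ψ^n` are ring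
endomorphisms (`adamsFun_mul`) with `ψ^i ψ^j = ψ^{ij}` (`adamsFun_adamsFun`), and `ψ^p` lifts
Frobenius (`prime_dvd_adamsFun_sub`).

On `ℤ[x]/(x^3)` this gives `ψ^n(x) = b_n x + c_n x^2`. Commutation reads `c_m b_n(b_n-1) = c_n
b_m(b_m-1)`, and `ψ^2(x) ≡ x^2` mod 2 makes `b_2` even and `c_2` odd. Since `c_2 ≠ 0`, `ψ^2`
controls every other `ψ^m`. An element of `Endbar` is nearly triangular by the congruences at large
primes; commuting with `ψ^2` makes it `1 ↦ a`, `x ↦ jx + kx^2`, `x^2 ↦ tx^2` with `c_2(t-j) = k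
b_2(b_2-1)`, and this condition suffices (`mem_H0_iff`). Both matrix descriptions, commutativity and
the rank follow from this one linear equation. In the classification, `b_2 = 0` forces all `b_p =
0`; otherwise `(c_p)` is proportional to `(b_p(b_p-1))`, with factor `h/G`. -/

/-! ### The Newton relations -/

/-- The Newton relations between a sequence `a` of elementary symmetric functions and a sequence
`p` of power sums. -/
structure IsNewton {A : Type*} [CommRing A] (a p : ℕ → A) : Prop where
  zero : a 0 = 1
  succ : ∀ n : ℕ, ((n + 1 : ℕ) : A) * a (n + 1) =
    ∑ m ∈ Finset.range (n + 1), (-1) ^ (n - m) * a m * p (n + 1 - m)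

/-- `n!` times the `n`-th elementary symmetric function, as an integral polynomial in the power
sums. -/
def factorialEsymm {A : Type*} [CommRing A] (p : ℕ → A) : ℕ → A
  | 0 => 1
  | n + 1 => ∑ m : Fin (n + 1),
      (-1) ^ (n - m) * (n.descFactorial (n - m) : A) * factorialEsymm p m * p (n + 1 - m)

section Newton

variable {A B : Type*} [CommRing A] [CommRing B]

lemma factorialEsymm_zero (p : ℕ → A) : factorialEsymm p 0 = 1 := by
  rw [factorialEsymm]

lemma factorialEsymm_succ (p : ℕ → A) (n : ℕ) : factorialEsymm p (n + 1) =
    ∑ m ∈ Finset.range (n + 1),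
      (-1) ^ (n - m) * (n.descFactorial (n - m) : A) * factorialEsymm p m * p (n + 1 - m) := by
  rw [factorialEsymm, Finset.sum_range]

lemma map_factorialEsymm (f : A →+* B) (p : ℕ → A) (n : ℕ) :
    f (factorialEsymm p n) = factorialEsymm (fun k => f (p k)) n := by
  induction n using Nat.strong_induction_on with
  | _ n ih =>
    cases n with
    | zero => simp [factorialEsymm_zero]
    | succ n =>
      rw [factorialEsymm_succ, factorialEsymm_succ, map_sum]
      refine Finset.sum_congr rfl fun m hm => ?_
      simp [ih m (Finset.mem_range.1 hm)]

/-- Index 0 is never read, so the convention `ψ^0 = 0` need not match the zeroth power sum. -/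
lemma factorialEsymm_congr {p p' : ℕ → A} (n : ℕ) (h : ∀ k, 0 < k → k ≤ n → p k = p' k) :
    factorialEsymm p n = factorialEsymm p' n := by
  induction n using Nat.strong_induction_on with
  | _ n ih =>
    cases n with
    | zero => simp [factorialEsymm_zero]
    | succ n =>
      rw [factorialEsymm_succ, factorialEsymm_succ]
      refine Finset.sum_congr rfl fun m hm => ?_
      rw [Finset.mem_range] at hm
      rw [ih m hm fun k h1 h2 => h k h1 (by omega), h (n + 1 - m) (by omega) (by omega)]

/-- Over a torsion-free ring the power sums are determined by the elementary symmetric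
functions. -/
lemma eq_of_factorialEsymm_eq [IsAddTorsionFree A] {p p' : ℕ → A} (N : ℕ)
    (h : ∀ n ≤ N, factorialEsymm p n = factorialEsymm p' n) :
    ∀ n, 0 < n → n ≤ N → p n = p' n := by
  intro n
  induction n using Nat.strong_induction_on with
  | _ n ih =>
    intro h0 hN
    obtain ⟨n, rfl⟩ := Nat.exists_eq_succ_of_ne_zero h0.ne'
    have e := h _ hN
    -- Only the term `m = 0` contains `p (n + 1)`; its coefficient is `±n!`, which torsion-freeness
    -- cancels.
    rw [Nat.succ_eq_add_one, factorialEsymm_succ, factorialEsymm_succ, Finset.sum_range_succ',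
      Finset.sum_range_succ' (fun m => (-1) ^ (n - m) * (n.descFactorial (n - m) : A) *
        factorialEsymm p' m * p' (n + 1 - m))] at e
    have e' : ∑ k ∈ Finset.range n, (-1 : A) ^ (n - (k + 1)) *
        (n.descFactorial (n - (k + 1)) : A) * factorialEsymm p (k + 1) * p (n + 1 - (k + 1)) =
        ∑ k ∈ Finset.range n, (-1 : A) ^ (n - (k + 1)) *
        (n.descFactorial (n - (k + 1)) : A) * factorialEsymm p' (k + 1) *
          p' (n + 1 - (k + 1)) := by
      refine Finset.sum_congr rfl fun m hm => ?_
      rw [Finset.mem_range] at hm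
      rw [h (m + 1) (by omega), ih (n + 1 - (m + 1)) (by omega) (by omega) (by omega)]
    rw [e'] at e
    have e2 := add_left_cancel e
    simp only [factorialEsymm_zero, Nat.sub_zero, mul_one, mul_assoc] at e2
    have e3 := ((isUnit_one.neg).pow n).mul_left_cancel e2
    rw [← nsmul_eq_mul, ← nsmul_eq_mul] at e3
    exact nsmul_right_injective (by simp [Nat.descFactorial_self, Nat.factorial_ne_zero]) e3

/-- Multiply the relation for `(n+1) a_{n+1}` by `n!` and split `n!` as `m!` times a descending
factorial in each term. -/
lemma IsNewton.factorial_mul {a p : ℕ → A} (h : IsNewton a p) (n : ℕ) :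
    (n.factorial : A) * a n = factorialEsymm p n := by
  induction n using Nat.strong_induction_on with
  | _ n ih =>
    cases n with
    | zero => simp [factorialEsymm_zero, h.zero]
    | succ n =>
      rw [Nat.factorial_succ, mul_comm (n + 1), Nat.cast_mul, mul_assoc, h.succ,
        factorialEsymm_succ, Finset.mul_sum]
      refine Finset.sum_congr rfl fun m hm => ?_
      rw [Finset.mem_range] at hm
      rw [← ih m hm, ← Nat.factorial_mul_descFactorial (Nat.sub_le n m)]
      have : n - (n - m) = m := by omega
      rw [this]
      push_cast
      ring

lemma IsNewton.map (f : A →+* B) {a p : ℕ → A} (h : IsNewton a p) :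
    IsNewton (fun k => f (a k)) (fun k => f (p k)) := by
  refine ⟨by simp [h.zero], fun n => ?_⟩
  have := congrArg f (h.succ n)
  simpa using this

lemma IsNewton.of_injective {f : A →+* B} (hf : Function.Injective f) {a p : ℕ → A}
    (h : IsNewton (fun k => f (a k)) (fun k => f (p k))) : IsNewton a p := by
  refine ⟨hf (by simpa using h.zero), fun n => hf ?_⟩
  have := h.succ n
  simpa using this

/-- The power sums are determined by the elementary symmetric functions. -/
lemma IsNewton.unique {a p a' p' : ℕ → A} (h : IsNewton a p) (h' : IsNewton a' p') (N : ℕ)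
    (e : ∀ n ≤ N, a n = a' n) : ∀ n, 0 < n → n ≤ N → p n = p' n := by
  intro n
  induction n using Nat.strong_induction_on with
  | _ n ih =>
    intro h0 hN
    obtain ⟨n, rfl⟩ := Nat.exists_eq_succ_of_ne_zero h0.ne'
    have e1 := h.succ n
    -- Here `p (n + 1)` has coefficient `±a 0 = ±1`, so no torsion hypothesis is needed.
    rw [e (n + 1) hN, h'.succ n, Finset.sum_range_succ',
      Finset.sum_range_succ' (fun m => (-1) ^ (n - m) * a m * p (n + 1 - m))] at e1
    have e' : ∑ k ∈ Finset.range n, (-1 : A) ^ (n - (k + 1)) * a' (k + 1) *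
          p' (n + 1 - (k + 1)) =
        ∑ k ∈ Finset.range n, (-1 : A) ^ (n - (k + 1)) * a (k + 1) * p (n + 1 - (k + 1)) := by
      refine Finset.sum_congr rfl fun m hm => ?_
      rw [Finset.mem_range] at hm
      rw [e (m + 1) (by omega), ih (n + 1 - (m + 1)) (by omega) (by omega) (by omega)]
    rw [e'] at e1
    have e2 := add_left_cancel e1
    simp only [h.zero, h'.zero, Nat.sub_zero, mul_one] at e2
    exact (((isUnit_one.neg).pow n).mul_left_cancel e2).symm

/-- The `k`-th elementary symmetric function of a finite family. -/
def esymmOf {ι : Type*} [Fintype ι] (y : ι → A) (k : ℕ) : A :=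
  ∑ S ∈ Finset.powersetCard k (Finset.univ : Finset ι), ∏ i ∈ S, y i

lemma aeval_esymm {ι : Type*} [Fintype ι] [Algebra ℤ A] (y : ι → A) (k : ℕ) :
    MvPolynomial.aeval y (MvPolynomial.esymm ι ℤ k) = esymmOf y k := by
  simp [MvPolynomial.esymm, esymmOf]

lemma isNewton_esymmOf {ι : Type*} [Fintype ι] (y : ι → A) :
    IsNewton (esymmOf y) (fun k => ∑ i, y i ^ k) := by
  refine ⟨by simp [esymmOf], fun n => ?_⟩
  have h := congrArg (MvPolynomial.aeval y) (MvPolynomial.mul_esymm_eq_sum ι ℤ (n + 1))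
  rw [map_mul, aeval_esymm, map_natCast] at h
  rw [h, Finset.Nat.antidiagonal_eq_map, Finset.filter_map, Finset.sum_map]
  have hf : (Finset.range (n + 1).succ).filter
      ((fun a : ℕ × ℕ => a.1 < n + 1) ∘ fun i => (i, n + 1 - i)) = Finset.range (n + 1) := by
    ext m
    simp
    omega
  simp only [map_mul, map_sum, map_pow, map_neg, map_one,
    aeval_esymm, MvPolynomial.psum, MvPolynomial.aeval_X]
  erw [hf]
  rw [Finset.mul_sum]
  refine Finset.sum_congr rfl fun m hm => ?_
  rw [Finset.mem_range] at hm
  obtain ⟨k, rfl⟩ : ∃ k, n = m + k := ⟨n - m, by omega⟩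
  have h2 : ((-1 : A) ^ m) * (-1) ^ m = 1 := by rw [← pow_add, Even.neg_one_pow ⟨m, rfl⟩]
  have h3 : m + k - m = k := by omega
  rw [h3]
  generalize ∑ i, y i ^ (m + k + 1 - m) = z
  rw [pow_add, pow_add]
  linear_combination (-1) ^ k * esymmOf y m * z * h2

/-- Turns the generating products that define `P_i` and `P_{i,j}` into elementary symmetric
functions of families of monomials. -/
lemma coeff_prod_one_add {ι : Type*} [Fintype ι] (y : ι → A) (k : ℕ) :
    (∏ i, (1 + Polynomial.C (y i) * Polynomial.X)).coeff k = esymmOf y k := by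
  have h : ∀ S : Finset ι, (∏ i ∈ S, Polynomial.C (y i) * Polynomial.X).coeff k =
      if S.card = k then ∏ i ∈ S, y i else 0 := by
    intro S
    rw [Finset.prod_mul_distrib, ← map_prod, Finset.prod_const, Polynomial.coeff_C_mul_X_pow]
    simp [eq_comm]
  rw [Finset.prod_one_add, Polynomial.finsetSum_coeff, esymmOf]
  simp only [h]
  rw [← Finset.sum_filter, ← Finset.powersetCard_eq_filter]

lemma map_esymmOf {ι : Type*} [Fintype ι] (f : A →+* B) (y : ι → A) (k : ℕ) :
    f (esymmOf y k) = esymmOf (fun i => f (y i)) k := by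
  simp [esymmOf]

end Newton

/-! ### Adams operations as power sums -/

namespace LambdaCohomology.LambdaRing

variable {R : Type*} [CommRing R] (L : LambdaRing R)

lemma isNewton (r : R) : IsNewton (fun k => L.lam k r) (L.adamsFun r) := by
  refine ⟨L.lam_zero r, fun n => ?_⟩
  have h := L.newton r (n + 1) n.succ_pos
  have e : (-1 : R) ^ (n + 1) * (-1) ^ (n + 1) = 1 := by
    rw [← pow_add, Even.neg_one_pow ⟨n + 1, rfl⟩]
  have h2 : ((n + 1 : ℕ) : R) * L.lam (n + 1) r = (-1) ^ n *
      ∑ i ∈ Finset.range (n + 1), (-1) ^ i * L.lam i r * L.adamsFun r (n + 1 - i) := by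
    have e2 := eq_neg_of_add_eq_zero_right h
    calc _ = (-1 : R) ^ (n + 1) * (-1) ^ (n + 1) * (((n + 1 : ℕ) : R) * L.lam (n + 1) r) := by
          rw [e, one_mul]
      _ = (-1 : R) ^ (n + 1) * ((-1) ^ (n + 1) * ((n + 1 : ℕ) : R) * L.lam (n + 1) r) := by ring
      _ = _ := by rw [e2]; ring
  rw [h2, Finset.mul_sum]
  refine Finset.sum_congr rfl fun m hm => ?_
  rw [Finset.mem_range] at hm
  obtain ⟨k, rfl⟩ : ∃ k, n = m + k := ⟨n - m, by omega⟩
  have h2 : ((-1 : R) ^ m) * (-1) ^ m = 1 := by rw [← pow_add, Even.neg_one_pow ⟨m, rfl⟩]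
  have h3 : m + k - m = k := by omega
  rw [h3, pow_add]
  linear_combination (-1) ^ k * L.lam m r * L.adamsFun r (m + k + 1 - m) * h2

lemma factorial_mul_lam (r : R) (n : ℕ) :
    (n.factorial : R) * L.lam n r = factorialEsymm (L.adamsFun r) n :=
  (L.isNewton r).factorial_mul n

/-- The sequence `1, 1, 0, 0, …` of the `λ^k(1)` is that of a single variable equal to 1, whose
power sums are all 1. -/
lemma adamsFun_one (n : ℕ) (hn : 0 < n) : L.adamsFun 1 n = 1 := by
  have h : IsNewton (fun k => L.lam k 1) (fun _ => 1) := by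
    refine ⟨L.lam_zero 1, fun n => ?_⟩
    cases n with
    | zero => simp [L.lam_zero, L.lam_one]
    | succ n =>
      rw [L.lam_of_one _ (by omega), Finset.sum_range_succ', Finset.sum_range_succ',
        Finset.sum_eq_zero]
      · simp [L.lam_zero, L.lam_one, pow_succ]
      · intro m _
        rw [L.lam_of_one _ (by omega)]
        simp
  exact (L.isNewton 1).unique h n (fun _ _ => rfl) n hn le_rfl

end LambdaCohomology.LambdaRing

noncomputable section

/-! ### Universal power sums -/

section Universal

variable {A B : Type*} [CommRing A] [CommRing B]

/-- The sequence `1, v_0, …, v_{N-1}, 0, 0, …`. -/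
def unitSeq {N : ℕ} (v : Fin N → A) (k : ℕ) : A :=
  if k = 0 then 1 else if h : k - 1 < N then v ⟨k - 1, h⟩ else 0

lemma map_unitSeq {N : ℕ} (f : A →+* B) (v : Fin N → A) (k : ℕ) :
    f (unitSeq v k) = unitSeq (fun i => f (v i)) k := by
  unfold unitSeq
  split_ifs <;> simp

lemma unitSeq_eq_of_le {N : ℕ} (a : ℕ → A) (h0 : a 0 = 1) (k : ℕ) (hk : k ≤ N) :
    unitSeq (fun i : Fin N => a (i + 1)) k = a k := by
  unfold unitSeq
  split_ifs with h h'
  · rw [h, h0]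
  · simp only
    congr 1
    omega
  · omega

/-- Padding by zeros is exact, since `N` elements have no elementary symmetric function of degree
above `N`. -/
lemma unitSeq_esymmOf {N : ℕ} (y : Fin N → A) (k : ℕ) :
    unitSeq (fun i : Fin N => esymmOf y (i + 1)) k = esymmOf y k := by
  rcases le_or_gt k N with h | h
  · exact unitSeq_eq_of_le _ (isNewton_esymmOf y).zero k h
  · have e : Finset.powersetCard k (Finset.univ : Finset (Fin N)) = ∅ := by
      rw [Finset.powersetCard_eq_empty]
      simpa using h
    rw [esymmOf, e, Finset.sum_empty, unitSeq, if_neg (by omega), dif_neg (by omega)]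

/-- Evaluation of a polynomial in `N` variables at the elementary symmetric polynomials. -/
def evalEsymm (N : ℕ) : MvPolynomial (Fin N) A →ₐ[A] MvPolynomial (Fin N) A :=
  MvPolynomial.aeval fun k : Fin N => MvPolynomial.esymm (Fin N) A (k + 1)

/-- Algebraic independence of the elementary symmetric polynomials; universal identities can
therefore be checked on the variables `ξ`. -/
lemma evalEsymm_injective (N : ℕ) : Function.Injective (evalEsymm (A := A) N) := by
  intro p q h
  apply MvPolynomial.esymmAlgHom_injective (σ := Fin N) A (n := N) (by simp)
  apply Subtype.ext
  rwa [MvPolynomial.esymmAlgHom_apply, MvPolynomial.esymmAlgHom_apply]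

lemma esymmOf_X {ι : Type*} [Fintype ι] (k : ℕ) :
    esymmOf (MvPolynomial.X : ι → MvPolynomial ι A) k = MvPolynomial.esymm ι A k := rfl

lemma exists_universalPsum (N : ℕ) : ∃ p : ℕ → MvPolynomial (Fin N) ℤ,
    IsNewton (unitSeq MvPolynomial.X) p ∧
      ∀ k, evalEsymm N (p k) = ∑ i, MvPolynomial.X i ^ k := by
  have h : ∀ k, ∃ Q : MvPolynomial (Fin N) ℤ, evalEsymm N Q = ∑ i, MvPolynomial.X i ^ k :=
    fun k => LambdaCohomology.exists_esymm_of_isSymmetric _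
      (MvPolynomial.psum_isSymmetric (Fin N) ℤ k)
  choose p hp using h
  refine ⟨p, IsNewton.of_injective (f := (evalEsymm N).toRingHom) (evalEsymm_injective N) ?_, hp⟩
  convert isNewton_esymmOf (MvPolynomial.X : Fin N → MvPolynomial (Fin N) ℤ) using 1
  · funext k
    rw [map_unitSeq, ← unitSeq_esymmOf]
    simp [evalEsymm, esymmOf_X]
  · funext k
    exact hp k

/-- The universal polynomial expressing the `k`-th power sum of `N` variables through the elementary
symmetric functions. -/
def universalPsum (N : ℕ) : ℕ → MvPolynomial (Fin N) ℤ := (exists_universalPsum N).choose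

lemma isNewton_universalPsum (N : ℕ) : IsNewton (unitSeq MvPolynomial.X) (universalPsum N) :=
  (exists_universalPsum N).choose_spec.1

lemma evalEsymm_universalPsum (N k : ℕ) :
    evalEsymm N (universalPsum N k) = ∑ i, MvPolynomial.X i ^ k :=
  (exists_universalPsum N).choose_spec.2 k

/-- The universal polynomial `P_i` is determined by the power sums. -/
lemma factorial_mul_prodPoly (i : ℕ) :
    (i.factorial : MvPolynomial (Fin i ⊕ Fin i) ℤ) * LambdaCohomology.prodPoly i =
      factorialEsymm (fun k => MvPolynomial.rename Sum.inl (universalPsum i k) *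
        MvPolynomial.rename Sum.inr (universalPsum i k)) i := by
  let φ : MvPolynomial (Fin i ⊕ Fin i) ℤ →ₐ[ℤ] MvPolynomial (Fin i ⊕ Fin i) ℤ :=
    MvPolynomial.aeval (Sum.elim (fun k : Fin i => LambdaCohomology.esymmXi i (k + 1))
      (fun k : Fin i => LambdaCohomology.esymmEta i (k + 1)))
  -- Regard the ring as polynomials in `ξ` over polynomials in `η` and use algebraic independence
  -- once for each set.
  have hφ : Function.Injective φ := by
    let S := MvPolynomial.sumAlgEquiv ℤ (Fin i) (Fin i)
    let ψ : MvPolynomial (Fin i ⊕ Fin i) ℤ →ₐ[ℤ] MvPolynomial (Fin i) (MvPolynomial (Fin i) ℤ) :=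
      ((evalEsymm i).restrictScalars ℤ).comp
        ((MvPolynomial.mapAlgHom (evalEsymm i)).comp S.toAlgHom)
    have e : S.toAlgHom.comp φ = ψ := by
      apply MvPolynomial.algHom_ext
      rintro (k | k)
      · simp [S, φ, ψ, evalEsymm, LambdaCohomology.esymmXi, MvPolynomial.esymm]
      · simp [S, φ, ψ, evalEsymm, LambdaCohomology.esymmEta, MvPolynomial.esymm]
    have hψ : Function.Injective ψ :=
      (evalEsymm_injective i).comp
        ((MvPolynomial.map_injective _ (evalEsymm_injective i)).comp S.injective)
    rw [← e] at hψ
    exact Function.Injective.of_comp (f := S) hψ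
  have hl : ∀ q, φ (MvPolynomial.rename Sum.inl q) = MvPolynomial.rename Sum.inl (evalEsymm i q) := by
    intro q
    have : φ.comp (MvPolynomial.rename Sum.inl) =
        (MvPolynomial.rename Sum.inl).comp (evalEsymm i) := by
      apply MvPolynomial.algHom_ext
      intro k
      simp [φ, evalEsymm, LambdaCohomology.esymmXi]
    exact DFunLike.congr_fun this q
  have hr : ∀ q, φ (MvPolynomial.rename Sum.inr q) = MvPolynomial.rename Sum.inr (evalEsymm i q) := by
    intro q
    have : φ.comp (MvPolynomial.rename Sum.inr) =
        (MvPolynomial.rename Sum.inr).comp (evalEsymm i) := by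
      apply MvPolynomial.algHom_ext
      intro k
      simp [φ, evalEsymm, LambdaCohomology.esymmEta]
    exact DFunLike.congr_fun this q
  apply hφ
  have h := map_factorialEsymm φ.toRingHom (fun k => MvPolynomial.rename Sum.inl (universalPsum i k) *
        MvPolynomial.rename Sum.inr (universalPsum i k)) i
  refine Eq.trans ?_ h.symm
  -- The coefficient is the `i`-th elementary symmetric function of the `ξ_m η_n`, whose power sums
  -- factor as `p_k(ξ) p_k(η)`.
  rw [map_mul, map_natCast, LambdaCohomology.prodPoly_spec, LambdaCohomology.prodSeries,
    ← Fintype.prod_prod_type' (f := fun m n : Fin i => (1 + Polynomial.C (MvPolynomial.X (R := ℤ)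
      (Sum.inl m : Fin i ⊕ Fin i) * MvPolynomial.X (Sum.inr n)) * Polynomial.X)),
    coeff_prod_one_add (fun x : Fin i × Fin i => MvPolynomial.X (R := ℤ)
      (Sum.inl x.1 : Fin i ⊕ Fin i) * MvPolynomial.X (Sum.inr x.2)), (isNewton_esymmOf _).factorial_mul]
  congr 1
  funext k
  change _ = φ _
  rw [map_mul, hl, hr, evalEsymm_universalPsum, map_sum, map_sum, Finset.sum_mul_sum,
    Fintype.sum_prod_type]
  simp [mul_pow]

/-- The universal polynomial `P_{i,j}` is determined by the power sums. -/
lemma exists_factorial_mul_compPoly (i j : ℕ) : ∃ E : ℕ → MvPolynomial (Fin (i * j)) ℤ,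
    (∀ k, (j.factorial : MvPolynomial (Fin (i * j)) ℤ) * E k =
      factorialEsymm (fun l => universalPsum (i * j) (k * l)) j) ∧
    (i.factorial : MvPolynomial (Fin (i * j)) ℤ) * LambdaCohomology.compPoly i j =
      factorialEsymm E i := by
  -- `E k` is the `j`-th elementary symmetric function of the `ξ_l^k`, that is, the `k`-th power sum
  -- of the `j`-fold products.
  have h : ∀ k, ∃ Q : MvPolynomial (Fin (i * j)) ℤ,
      evalEsymm (i * j) Q = esymmOf (fun l => MvPolynomial.X l ^ k) j := by
    intro k
    refine LambdaCohomology.exists_esymm_of_isSymmetric _ ?_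
    have := MvPolynomial.esymm_isSymmetric (Fin (i * j)) ℤ j
    intro e
    have h1 := map_esymmOf (MvPolynomial.rename (R := ℤ) e).toRingHom
      (fun l : Fin (i * j) => MvPolynomial.X l ^ k) j
    refine Eq.trans h1 ?_
    have h2 := congrArg (MvPolynomial.aeval
      (fun l : Fin (i * j) => (MvPolynomial.X l ^ k : MvPolynomial (Fin (i * j)) ℤ))) (this e)
    rw [MvPolynomial.aeval_rename, aeval_esymm, aeval_esymm] at h2
    rw [← h2]
    simp [Function.comp_def]
  choose E hE using h
  refine ⟨E, fun k => evalEsymm_injective (i * j) ?_, evalEsymm_injective (i * j) ?_⟩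
  · refine Eq.trans ?_ (map_factorialEsymm (evalEsymm (i * j)).toRingHom _ j).symm
    rw [map_mul, map_natCast, hE, (isNewton_esymmOf _).factorial_mul]
    congr 1
    funext l
    change _ = evalEsymm (i * j) _
    rw [evalEsymm_universalPsum]
    simp [pow_mul]
  · refine Eq.trans ?_ (map_factorialEsymm (evalEsymm (i * j)).toRingHom _ i).symm
    rw [map_mul, map_natCast]
    have h1 : evalEsymm (i * j) (LambdaCohomology.compPoly i j) = _ :=
      LambdaCohomology.compPoly_spec i j
    rw [h1, LambdaCohomology.compSeries, ← Finset.prod_coe_sort, coeff_prod_one_add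
      (fun S : ↥(Finset.powersetCard j (Finset.univ : Finset (Fin (i * j)))) =>
        ∏ l ∈ S.1, MvPolynomial.X (R := ℤ) l), (isNewton_esymmOf _).factorial_mul]
    congr 1
    funext k
    change _ = evalEsymm (i * j) _
    rw [hE, esymmOf, Finset.sum_coe_sort (Finset.powersetCard j Finset.univ)
      (fun S : Finset (Fin (i * j)) => (∏ l ∈ S, MvPolynomial.X (R := ℤ) l) ^ k)]
    simp [Finset.prod_pow]

/-- Modulo a prime `p`, the `p`-th power sum is the `p`-th power of the first elementary symmetric
function. -/
lemma prime_dvd_universalPsum_sub (p : ℕ) (hp : p.Prime) (N : ℕ) :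
    (p : MvPolynomial (Fin N) ℤ) ∣ universalPsum N p - (unitSeq MvPolynomial.X 1) ^ p := by
  have h1 : evalEsymm N (unitSeq (MvPolynomial.X : Fin N → MvPolynomial (Fin N) ℤ) 1) =
      ∑ i, MvPolynomial.X i := by
    have h := map_unitSeq (evalEsymm (A := ℤ) N).toRingHom MvPolynomial.X 1
    refine Eq.trans h ?_
    have e := unitSeq_esymmOf (MvPolynomial.X : Fin N → MvPolynomial (Fin N) ℤ) 1
    have e2 : (fun i => (evalEsymm (A := ℤ) N).toRingHom (MvPolynomial.X i)) =
      (fun i : Fin N => esymmOf (MvPolynomial.X : Fin N → MvPolynomial (Fin N) ℤ) (i + 1)) := by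
      funext i
      simp [evalEsymm, esymmOf_X]
    rw [e2, e, esymmOf_X, MvPolynomial.esymm_one]
  have h2 : ∀ s : Finset (Fin N), (p : MvPolynomial (Fin N) ℤ) ∣
      (∑ i ∈ s, MvPolynomial.X i) ^ p - ∑ i ∈ s, MvPolynomial.X i ^ p := by
    intro s
    induction s using Finset.induction_on with
    | empty => simp [hp.ne_zero]
    | insert a s ha ih =>
      rw [Finset.sum_insert ha, Finset.sum_insert ha]
      have := dvd_add ih (LambdaCohomology.dvd_add_pow_sub hp
        (MvPolynomial.X a : MvPolynomial (Fin N) ℤ) (∑ i ∈ s, MvPolynomial.X i))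
      convert this using 1
      ring
  obtain ⟨c, hc⟩ := h2 Finset.univ
  have hc' : (p : MvPolynomial (Fin N) ℤ) ∣
      MvPolynomial.psum (Fin N) ℤ p - (MvPolynomial.psum (Fin N) ℤ 1) ^ p := by
    refine ⟨-c, ?_⟩
    simp only [MvPolynomial.psum, pow_one]
    linear_combination -hc
  clear hc c
  obtain ⟨c, hc⟩ := hc'
  -- The quotient by `p` is again symmetric, so the divisibility descends to polynomials in the
  -- elementary symmetric functions.
  have hsym : c.IsSymmetric := by
    intro e
    have h0 : (p : MvPolynomial (Fin N) ℤ) ≠ 0 := by exact_mod_cast hp.ne_zero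
    apply mul_left_cancel₀ h0
    have := congrArg (MvPolynomial.rename e) hc
    rw [map_sub, map_pow, MvPolynomial.psum_isSymmetric, MvPolynomial.psum_isSymmetric, hc,
      map_mul, map_natCast] at this
    exact this.symm
  obtain ⟨d, hd⟩ := LambdaCohomology.exists_esymm_of_isSymmetric c hsym
  refine ⟨d, evalEsymm_injective N ?_⟩
  have hd' : evalEsymm N d = c := hd
  rw [map_sub, map_pow, h1, evalEsymm_universalPsum, map_mul, map_natCast, hd', ← hc]
  simp [MvPolynomial.psum]

end Universal

/-! ### Adams operations as commuting Frobenius lifts -/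

namespace LambdaCohomology.LambdaRing

variable {R : Type*} [CommRing R] (L : LambdaRing R)

/-- The bound `k ≤ N` matters: `unitSeq` stops at `N`, while the `λ^k(r)` need not. -/
lemma aeval_universalPsum (r : R) (N k : ℕ) (hk : 0 < k) (hN : k ≤ N) :
    MvPolynomial.aeval (fun i : Fin N => L.lam (i + 1) r) (universalPsum N k) = L.adamsFun r k := by
  have h := (isNewton_universalPsum N).map
    (MvPolynomial.aeval (fun i : Fin N => L.lam (i + 1) r)).toRingHom
  refine h.unique (L.isNewton r) N (fun n hn => ?_) k hk hN
  rw [map_unitSeq]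
  refine Eq.trans ?_ (unitSeq_eq_of_le (fun k => L.lam k r) (L.lam_zero r) n hn)
  simp

/-- The Adams operation `ψ^p` lifts the Frobenius map. -/
lemma prime_dvd_adamsFun_sub (p : ℕ) (hp : p.Prime) (r : R) :
    (p : R) ∣ L.adamsFun r p - r ^ p := by
  obtain ⟨c, hc⟩ := prime_dvd_universalPsum_sub p hp p
  have h := congrArg (MvPolynomial.aeval (fun i : Fin p => L.lam (i + 1) r)) hc
  have h1 : MvPolynomial.aeval (fun i : Fin p => L.lam (i + 1) r)
      (unitSeq (MvPolynomial.X : Fin p → MvPolynomial (Fin p) ℤ) 1) = r := by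
    have e := map_unitSeq (MvPolynomial.aeval (fun i : Fin p => L.lam (i + 1) r)).toRingHom
      (MvPolynomial.X : Fin p → MvPolynomial (Fin p) ℤ) 1
    refine e.trans (Eq.trans ?_ ((unitSeq_eq_of_le (fun k => L.lam k r) (L.lam_zero r) 1
      hp.one_lt.le).trans (L.lam_one r)))
    simp
  rw [map_sub, map_pow, L.aeval_universalPsum r p p hp.pos le_rfl, h1, map_mul, map_natCast] at h
  exact ⟨_, h⟩

variable [IsAddTorsionFree R]

/-- The product axiom says that the sequences `ψ^k(rs)` and `ψ^k(r) ψ^k(s)` both produce `i!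
λ^i(rs)`; power sums are determined by these values. -/
lemma adamsFun_mul (r s : R) (n : ℕ) (hn : 0 < n) :
    L.adamsFun (r * s) n = L.adamsFun r n * L.adamsFun s n := by
  refine eq_of_factorialEsymm_eq (p' := fun k => L.adamsFun r k * L.adamsFun s k) n
    (fun i _ => ?_) n hn le_rfl
  let ev : MvPolynomial (Fin i ⊕ Fin i) ℤ →ₐ[ℤ] R := MvPolynomial.aeval
    (Sum.elim (fun k : Fin i => L.lam (k + 1) r) (fun k : Fin i => L.lam (k + 1) s))
  have h := congrArg ev (factorial_mul_prodPoly i)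
  have h1 : ev (prodPoly i) = L.lam i (r * s) := (L.lam_mul i r s).symm
  rw [map_mul, map_natCast, h1, L.factorial_mul_lam] at h
  rw [h]
  refine (map_factorialEsymm ev.toRingHom _ i).trans (factorialEsymm_congr i fun k h0 hk => ?_)
  change ev _ = _
  rw [map_mul, MvPolynomial.aeval_rename, MvPolynomial.aeval_rename]
  exact congrArg₂ (· * ·) (L.aeval_universalPsum r i k h0 hk) (L.aeval_universalPsum s i k h0 hk)

/-- The Adams operation `ψ^n`, `n ≥ 1`, as a ring homomorphism. -/
def adamsHom (n : ℕ) (hn : 0 < n) : R →+* R where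
  toFun r := L.adamsFun r n
  map_one' := L.adamsFun_one n hn
  map_mul' r s := L.adamsFun_mul r s n hn
  map_zero' := by simpa using L.adamsFun_add 0 0 n
  map_add' r s := L.adamsFun_add r s n

lemma adamsHom_apply (n : ℕ) (hn : 0 < n) (r : R) : L.adamsHom n hn r = L.adamsFun r n := rfl

/-- In terms of formal roots, `ψ^i(λ^j(r))` is the `j`-th elementary symmetric function of their
`i`-th powers, whose `l`-th power sum is `ψ^{il}(r)`. -/
lemma factorial_mul_adamsFun_lam (r : R) (i j : ℕ) (hi : 0 < i) :
    (j.factorial : R) * L.adamsFun (L.lam j r) i =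
      factorialEsymm (fun l => L.adamsFun r (i * l)) j := by
  induction i using Nat.strong_induction_on with
  | _ i ih =>
    obtain ⟨E, hE, hP⟩ := exists_factorial_mul_compPoly i j
    let ev : MvPolynomial (Fin (i * j)) ℤ →ₐ[ℤ] R :=
      MvPolynomial.aeval fun k : Fin (i * j) => L.lam (k + 1) r
    have hF : ∀ k, 0 < k → k ≤ i → (j.factorial : R) * ev (E k) =
        factorialEsymm (fun l => L.adamsFun r (k * l)) j := by
      intro k h0 hk
      have h := congrArg ev (hE k)
      rw [map_mul, map_natCast] at h
      refine h.trans ((map_factorialEsymm ev.toRingHom _ j).trans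
        (factorialEsymm_congr j fun l hl hlj => ?_))
      exact L.aeval_universalPsum r (i * j) (k * l) (Nat.mul_pos h0 hl) (Nat.mul_le_mul hk hlj)
    have hlt : ∀ k, 0 < k → k < i → L.adamsFun (L.lam j r) k = ev (E k) := by
      intro k h0 hk
      have h := (ih k hk h0).trans (hF k h0 hk.le).symm
      rw [← nsmul_eq_mul, ← nsmul_eq_mul] at h
      exact nsmul_right_injective j.factorial_ne_zero h
    -- The polynomials `E` depend on `i`, so indices below `i` come from the induction hypothesis;
    -- the axiom for `λ^i(λ^j(r))` is needed only at `i`.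
    have hi' : L.adamsFun (L.lam j r) i = ev (E i) := by
      refine eq_of_factorialEsymm_eq (p' := fun k => ev (E k)) i (fun n hn => ?_) i hi le_rfl
      rcases hn.lt_or_eq with hn | rfl
      · exact factorialEsymm_congr n fun k h0 hk => hlt k h0 (by omega)
      · have h := congrArg ev hP
        have h1 : ev (compPoly n j) = L.lam n (L.lam j r) := (L.lam_lam n j r).symm
        rw [map_mul, map_natCast, h1, L.factorial_mul_lam] at h
        exact h.trans (map_factorialEsymm ev.toRingHom E n)
    rw [hi', hF i hi le_rfl]

/-- Apply the ring homomorphism `ψ^i` to the expression of `n! λ^n(r)` in power sums and compare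
with `factorial_mul_adamsFun_lam`. -/
lemma adamsFun_adamsFun (r : R) (i j : ℕ) (hi : 0 < i) (hj : 0 < j) :
    L.adamsFun (L.adamsFun r j) i = L.adamsFun r (i * j) := by
  refine eq_of_factorialEsymm_eq (p := fun j => L.adamsFun (L.adamsFun r j) i)
    (p' := fun j => L.adamsFun r (i * j)) j (fun n _ => ?_) j hj le_rfl
  rw [← L.factorial_mul_adamsFun_lam r i n hi]
  have h := congrArg (L.adamsHom i hi) (L.factorial_mul_lam r n)
  rw [map_mul, map_natCast, map_factorialEsymm] at h
  exact h.symm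

end LambdaCohomology.LambdaRing

end

noncomputable section

/-! ### Coordinates in `ℤ[x]/(x^3)` -/

namespace LambdaCohomology

/-- The element `α + β x + γ x^2` of `ℤ[x]/(x^3)`. -/
def tri (α β γ : ℤ) : Trunc3 := α + β * x3 + γ * x3 ^ 2

lemma x3_cube : x3 ^ 3 = 0 := by
  have h : AdjoinRoot.mk ((Polynomial.X : Polynomial ℤ) ^ 3) (Polynomial.X ^ 3) = 0 :=
    AdjoinRoot.mk_self
  rwa [map_pow, AdjoinRoot.mk_X] at h

lemma tri_eq_sum (α β γ : ℤ) : tri α β γ = ∑ i : Fin 3, ![α, β, γ] i • basis3 i := by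
  simp only [basis3_apply, Fin.sum_univ_three, tri, zsmul_eq_mul]
  simp

lemma repr_tri (α β γ : ℤ) (i : Fin 3) : basis3.repr (tri α β γ) i = ![α, β, γ] i := by
  rw [tri_eq_sum, basis3.repr_sum_self]

lemma exists_tri (r : Trunc3) : ∃ α β γ, r = tri α β γ := by
  refine ⟨basis3.repr r 0, basis3.repr r 1, basis3.repr r 2, ?_⟩
  apply basis3.repr.injective
  ext i
  rw [repr_tri]
  fin_cases i <;> rfl

lemma tri_inj {α β γ α' β' γ' : ℤ} : tri α β γ = tri α' β' γ' ↔ α = α' ∧ β = β' ∧ γ = γ' := by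
  refine ⟨fun h => ⟨?_, ?_, ?_⟩, ?_⟩
  · simpa [repr_tri] using congrArg (fun r => basis3.repr r 0) h
  · simpa [repr_tri] using congrArg (fun r => basis3.repr r 1) h
  · simpa [repr_tri] using congrArg (fun r => basis3.repr r 2) h
  · rintro ⟨rfl, rfl, rfl⟩
    rfl

lemma zero_eq_tri : (0 : Trunc3) = tri 0 0 0 := by simp [tri]

lemma x3_sq_eq_tri : x3 ^ 2 = tri 0 0 1 := by simp [tri]

lemma tri_add (α β γ α' β' γ' : ℤ) :
    tri α β γ + tri α' β' γ' = tri (α + α') (β + β') (γ + γ') := by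
  simp only [tri]; push_cast; ring

lemma tri_sub (α β γ α' β' γ' : ℤ) :
    tri α β γ - tri α' β' γ' = tri (α - α') (β - β') (γ - γ') := by
  simp only [tri]; push_cast; ring

lemma smul_tri (n α β γ : ℤ) : n • tri α β γ = tri (n * α) (n * β) (n * γ) := by
  simp only [tri, zsmul_eq_mul]; push_cast; ring

lemma tri_mul (α β γ α' β' γ' : ℤ) : tri α β γ * tri α' β' γ' =
    tri (α * α') (α * β' + β * α') (α * γ' + β * β' + γ * α') := by
  simp only [tri]
  push_cast
  linear_combination (β * γ' + γ * β' + γ * γ' * x3) * x3_cube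

lemma natCast_dvd_tri (n : ℕ) (α β γ : ℤ) :
    (n : Trunc3) ∣ tri α β γ ↔ (n : ℤ) ∣ α ∧ (n : ℤ) ∣ β ∧ (n : ℤ) ∣ γ := by
  constructor
  · rintro ⟨r, hr⟩
    obtain ⟨a, b, c, rfl⟩ := exists_tri r
    have h : (n : Trunc3) * tri a b c = (n : ℤ) • tri a b c := by simp
    rw [h, smul_tri, tri_inj] at hr
    exact ⟨⟨a, hr.1⟩, ⟨b, hr.2.1⟩, ⟨c, hr.2.2⟩⟩
  · rintro ⟨⟨a, rfl⟩, ⟨b, rfl⟩, ⟨c, rfl⟩⟩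
    rw [← smul_tri, zsmul_eq_mul, Int.cast_natCast]
    exact dvd_mul_right _ _

instance : IsAddTorsionFree Trunc3 :=
  Function.Injective.isAddTorsionFree basis3.repr.toLinearMap.toAddMonoidHom basis3.repr.injective

lemma int_prime_dvd_pow_sub {p : ℕ} (hp : p.Prime) (n : ℤ) : (p : ℤ) ∣ n ^ p - n := by
  have := Fact.mk hp
  rw [← ZMod.intCast_zmod_eq_zero_iff_dvd]
  simp

/-- For `p ≥ 3` the `p`-th power kills the nilpotent part, so Frobenius mod `p` is projection to the
constant term. Only `p = 2` retains the coefficient of `x`. -/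
lemma dvd_tri_pow_sub {p : ℕ} (hp : p.Prime) (h3 : 3 ≤ p) (α β γ : ℤ) :
    (p : Trunc3) ∣ tri α β γ ^ p - tri α 0 0 := by
  have h1 := dvd_add_pow_sub hp (α : Trunc3) (x3 * (β + γ * x3))
  have h2 : (x3 * (β + γ * x3)) ^ p = 0 := by
    rw [mul_pow, ← Nat.sub_add_cancel h3, pow_add x3, x3_cube]
    ring
  obtain ⟨c, hc⟩ := int_prime_dvd_pow_sub hp α
  have h3 : (α : Trunc3) ^ p - α = p * c := by exact_mod_cast congrArg (Int.cast : ℤ → Trunc3) hc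
  rw [h2, add_zero] at h1
  have := dvd_add h1 ⟨(c : Trunc3), h3⟩
  convert this using 1
  simp only [tri]
  ring

lemma two_dvd_tri_sq_sub (α β γ : ℤ) : ((2 : ℕ) : Trunc3) ∣ tri α β γ ^ 2 - tri α 0 β := by
  rw [pow_two, tri_mul, tri_sub, natCast_dvd_tri]
  refine ⟨?_, ⟨α * β, by push_cast; ring⟩, ?_⟩
  · have := int_prime_dvd_pow_sub Nat.prime_two α
    rwa [pow_two] at this
  · obtain ⟨w, hw⟩ := int_prime_dvd_pow_sub Nat.prime_two β
    refine ⟨w + α * γ, ?_⟩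
    push_cast at hw ⊢
    linear_combination hw

lemma eq_zero_of_forall_prime_dvd {a : ℤ} (h : ∀ p : ℕ, p.Prime → 3 ≤ p → (p : ℤ) ∣ a) :
    a = 0 := by
  obtain ⟨p, hle, hp⟩ := Nat.exists_infinite_primes (a.natAbs + 3)
  refine Int.eq_zero_of_abs_lt_dvd (h p hp (by omega)) ?_
  rw [Int.abs_eq_natAbs]
  omega

lemma end_tri (f : Module.End ℤ Trunc3) (α β γ : ℤ) :
    f (tri α β γ) = α • f 1 + β • f x3 + γ • f (x3 ^ 2) := by
  have : tri α β γ = α • 1 + β • x3 + γ • x3 ^ 2 := by simp [tri]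
  rw [this, map_add, map_add, map_zsmul, map_zsmul, map_zsmul]

lemma end_ext {f g : Module.End ℤ Trunc3} (h0 : f 1 = g 1) (h1 : f x3 = g x3)
    (h2 : f (x3 ^ 2) = g (x3 ^ 2)) : f = g := by
  ext r
  obtain ⟨α, β, γ, rfl⟩ := exists_tri r
  rw [end_tri, end_tri, h0, h1, h2]

/-- The endomorphism `1 ↦ a`, `x ↦ j x + k x^2`, `x^2 ↦ t x^2`. -/
def lowerEnd (a j k t : ℤ) : Module.End ℤ Trunc3 :=
  toMat.symm !![a, 0, 0; 0, j, 0; 0, k, t]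

lemma toMat_symm_basis3 (M : Matrix (Fin 3) (Fin 3) ℤ) (i : Fin 3) :
    toMat.symm M (basis3 i) = tri (M 0 i) (M 1 i) (M 2 i) := by
  rw [toMat, LinearMap.toMatrixAlgEquiv_symm, Matrix.toLinAlgEquiv_self, tri_eq_sum]
  simp [Fin.sum_univ_three]

lemma lowerEnd_one (a j k t : ℤ) : lowerEnd a j k t 1 = tri a 0 0 := by
  simpa [basis3_apply, lowerEnd] using toMat_symm_basis3 !![a, 0, 0; 0, j, 0; 0, k, t] 0

lemma lowerEnd_x3 (a j k t : ℤ) : lowerEnd a j k t x3 = tri 0 j k := by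
  simpa [basis3_apply, lowerEnd] using toMat_symm_basis3 !![a, 0, 0; 0, j, 0; 0, k, t] 1

lemma lowerEnd_x3_sq (a j k t : ℤ) : lowerEnd a j k t (x3 ^ 2) = tri 0 0 t := by
  simpa [basis3_apply, lowerEnd] using toMat_symm_basis3 !![a, 0, 0; 0, j, 0; 0, k, t] 2

lemma lowerEnd_tri (a j k t α β γ : ℤ) :
    lowerEnd a j k t (tri α β γ) = tri (α * a) (β * j) (β * k + γ * t) := by
  rw [end_tri, lowerEnd_one, lowerEnd_x3, lowerEnd_x3_sq, smul_tri, smul_tri, smul_tri, tri_add,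
    tri_add]
  simp

lemma toMat_lowerEnd (a j k t : ℤ) :
    toMat (lowerEnd a j k t) = !![a, 0, 0; 0, j, 0; 0, k, t] :=
  toMat.apply_symm_apply _

lemma eq_lowerEnd {f : Module.End ℤ Trunc3} {a j k t : ℤ} (h0 : f 1 = tri a 0 0)
    (h1 : f x3 = tri 0 j k) (h2 : f (x3 ^ 2) = tri 0 0 t) : f = lowerEnd a j k t :=
  end_ext (by rw [h0, lowerEnd_one]) (by rw [h1, lowerEnd_x3]) (by rw [h2, lowerEnd_x3_sq])

lemma lowerEnd_inj {a j k t a' j' k' t' : ℤ} (h : lowerEnd a j k t = lowerEnd a' j' k' t') :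
    a = a' ∧ j = j' ∧ k = k' ∧ t = t' := by
  have h0 := LinearMap.congr_fun h 1
  have h1 := LinearMap.congr_fun h x3
  have h2 := LinearMap.congr_fun h (x3 ^ 2)
  rw [lowerEnd_one, lowerEnd_one, tri_inj] at h0
  rw [lowerEnd_x3, lowerEnd_x3, tri_inj] at h1
  rw [lowerEnd_x3_sq, lowerEnd_x3_sq, tri_inj] at h2
  exact ⟨h0.1, h1.2.1, h1.2.2, h2.2.2⟩

lemma lowerEnd_mul (a j k t a' j' k' t' : ℤ) : lowerEnd a j k t * lowerEnd a' j' k' t' =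
    lowerEnd (a * a') (j * j') (k * j' + t * k') (t * t') := by
  apply eq_lowerEnd
  · rw [Module.End.mul_apply, lowerEnd_one, lowerEnd_tri, tri_inj]
    refine ⟨by ring, by ring, by ring⟩
  · rw [Module.End.mul_apply, lowerEnd_x3, lowerEnd_tri, tri_inj]
    refine ⟨by ring, by ring, by ring⟩
  · rw [Module.End.mul_apply, lowerEnd_x3_sq, lowerEnd_tri, tri_inj]
    refine ⟨by ring, by ring, by ring⟩

lemma lowerEnd_mem_Endbar {a j k t : ℤ} (h : 2 ∣ t - j) : lowerEnd a j k t ∈ Endbar Trunc3 := by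
  intro p hp r
  obtain ⟨α, β, γ, rfl⟩ := exists_tri r
  -- By linearity `r^p` may be replaced by any `s` congruent to it mod `p`. The parity hypothesis
  -- then enters only at `p = 2`.
  have key : ∀ s : Trunc3, (p : Trunc3) ∣ tri α β γ ^ p - s →
      (p : Trunc3) ∣ lowerEnd a j k t (tri α β γ) ^ p - lowerEnd a j k t s →
      (p : Trunc3) ∣ lowerEnd a j k t (tri α β γ) ^ p - lowerEnd a j k t (tri α β γ ^ p) := by
    rintro s ⟨c, hc⟩ h1
    have h2 : lowerEnd a j k t (tri α β γ ^ p) - lowerEnd a j k t s =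
        p * lowerEnd a j k t c := by
      rw [← map_sub, hc, ← nsmul_eq_mul, map_nsmul, nsmul_eq_mul]
    have h3 := dvd_sub h1 (Dvd.intro _ h2.symm)
    convert h3 using 1
    ring
  rcases hp.two_le.eq_or_lt with rfl | h3
  · refine key _ (two_dvd_tri_sq_sub α β γ) ?_
    rw [lowerEnd_tri, lowerEnd_tri]
    have h1 := dvd_sub (two_dvd_tri_sq_sub (α * a) (β * j) (β * k + γ * t))
      ((natCast_dvd_tri 2 0 0 (β * (t - j))).2
        ⟨dvd_zero _, dvd_zero _, Dvd.dvd.mul_left (by exact_mod_cast h) _⟩)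
    convert h1 using 1
    rw [sub_sub, tri_add]
    congr 2 <;> ring
  · refine key _ (dvd_tri_pow_sub hp h3 α β γ) ?_
    rw [lowerEnd_tri, lowerEnd_tri]
    convert dvd_tri_pow_sub hp h3 (α * a) (β * j) (β * k + γ * t) using 3
    all_goals ring

/-- The unwanted coefficients are divisible by every prime `p ≥ 3`, hence vanish. The coefficient
`s` survives here; commuting with `ψ^2` removes it later. -/
lemma Endbar_coords {f : Module.End ℤ Trunc3} (hf : f ∈ Endbar Trunc3) :
    ∃ a j k s t : ℤ, f 1 = tri a 0 0 ∧ f x3 = tri 0 j k ∧ f (x3 ^ 2) = tri 0 s t := by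
  obtain ⟨a, u, v, h0⟩ := exists_tri (f 1)
  obtain ⟨e, j, k, h1⟩ := exists_tri (f x3)
  obtain ⟨e', s, t, h2⟩ := exists_tri (f (x3 ^ 2))
  have hpow : ∀ p : ℕ, 3 ≤ p → x3 ^ p = 0 := fun p h => by
    rw [← Nat.sub_add_cancel h, pow_add, x3_cube, mul_zero]
  have H0 : ∀ p : ℕ, p.Prime → 3 ≤ p → (p : Trunc3) ∣ tri 0 u v := by
    intro p hp h3
    have h := dvd_sub (hf p hp 1) (dvd_tri_pow_sub hp h3 a u v)
    rw [one_pow, h0] at h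
    rw [← dvd_neg]
    convert h using 1
    rw [neg_eq_zero_sub, sub_sub_sub_cancel_left, zero_eq_tri, tri_sub, tri_sub]
    congr 1; ring
  have H1 : ∀ p : ℕ, p.Prime → 3 ≤ p → (p : Trunc3) ∣ tri e 0 0 := by
    intro p hp h3
    have h := dvd_sub (hf p hp x3) (dvd_tri_pow_sub hp h3 e j k)
    rw [hpow p h3, map_zero, h1] at h
    convert h using 1
    ring
  have H2 : ∀ p : ℕ, p.Prime → 3 ≤ p → (p : Trunc3) ∣ tri e' 0 0 := by
    intro p hp h3
    have h := dvd_sub (hf p hp (x3 ^ 2)) (dvd_tri_pow_sub hp h3 e' s t)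
    rw [← pow_mul, hpow (2 * p) (by omega), map_zero, h2] at h
    convert h using 1
    ring
  simp only [natCast_dvd_tri] at H0 H1 H2
  have hu : u = 0 := eq_zero_of_forall_prime_dvd fun p hp h3 => (H0 p hp h3).2.1
  have hv : v = 0 := eq_zero_of_forall_prime_dvd fun p hp h3 => (H0 p hp h3).2.2
  have he : e = 0 := eq_zero_of_forall_prime_dvd fun p hp h3 => (H1 p hp h3).1
  have he' : e' = 0 := eq_zero_of_forall_prime_dvd fun p hp h3 => (H2 p hp h3).1
  subst hu hv he he'
  exact ⟨a, j, k, s, t, h0, h1, h2⟩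

/-! ### λ-ring structures on `ℤ[x]/(x^3)` -/

namespace LambdaRing

variable (L : LambdaRing Trunc3)

lemma exists_adamsFun_x3 (n : ℕ) (hn : 0 < n) : ∃ b c : ℤ, L.adamsFun x3 n = tri 0 b c := by
  obtain ⟨a, b, c, h⟩ := exists_tri (L.adamsFun x3 n)
  have h3 : L.adamsHom n hn x3 ^ 3 = 0 := by rw [← map_pow, x3_cube, map_zero]
  rw [adamsHom_apply, h, pow_succ, pow_two, tri_mul, tri_mul, zero_eq_tri, tri_inj] at h3
  have ha : a = 0 := by simpa using h3.1
  exact ⟨b, c, by rw [h, ha]⟩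

lemma adamsFun_tri {n : ℕ} (hn : 0 < n) {b c : ℤ} (h : L.adamsFun x3 n = tri 0 b c)
    (α β γ : ℤ) : L.adamsFun (tri α β γ) n = tri α (β * b) (β * c + γ * b ^ 2) := by
  have h1 : L.adamsHom n hn x3 = tri 0 b c := h
  rw [← L.adamsHom_apply n hn, tri]
  simp only [map_add, map_mul, map_pow, map_intCast, h1]
  simp only [tri]
  push_cast
  linear_combination (γ * 2 * b * c + γ * c ^ 2 * x3) * x3_cube

/-- Compare the coefficients of `x^2` in `ψ^n ψ^m(x) = ψ^m ψ^n(x)`. -/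
lemma coeff_relation {m n : ℕ} (hm : 0 < m) (hn : 0 < n) {b c b' c' : ℤ}
    (h : L.adamsFun x3 m = tri 0 b c) (h' : L.adamsFun x3 n = tri 0 b' c') :
    c * (b' * (b' - 1)) = c' * (b * (b - 1)) := by
  have e : L.adamsFun (L.adamsFun x3 m) n = L.adamsFun (L.adamsFun x3 n) m := by
    rw [L.adamsFun_adamsFun x3 n m hn hm, L.adamsFun_adamsFun x3 m n hm hn, mul_comm]
  rw [h, h', L.adamsFun_tri hn h', L.adamsFun_tri hm h, tri_inj] at e
  linear_combination e.2.2

lemma two_dvd_coeff {b c : ℤ} (h : L.adamsFun x3 2 = tri 0 b c) : Even b ∧ Odd c := by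
  have h1 := L.prime_dvd_adamsFun_sub 2 Nat.prime_two x3
  rw [h, x3_sq_eq_tri, tri_sub, natCast_dvd_tri] at h1
  obtain ⟨-, ⟨u, hu⟩, ⟨v, hv⟩⟩ := h1
  push_cast at hu hv
  exact ⟨⟨u, by linarith⟩, ⟨v, by linarith⟩⟩

lemma prime_dvd_coeff {p : ℕ} (hp : p.Prime) {b c : ℤ}
    (h : L.adamsFun x3 p = tri 0 b c) : (p : ℤ) ∣ b := by
  have h1 := L.prime_dvd_adamsFun_sub p hp x3
  obtain ⟨u, v, w, e⟩ := exists_tri (x3 ^ (p - 2))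
  rw [h, ← Nat.sub_add_cancel hp.two_le, pow_add, e, x3_sq_eq_tri, tri_mul, tri_sub,
    natCast_dvd_tri, Nat.sub_add_cancel hp.two_le] at h1
  simpa using h1.2.1

/-- Commutation with `ψ^2` alone decides membership, because `c` is odd and so nonzero. -/
lemma mem_H0_iff {b c : ℤ} (h : L.adamsFun x3 2 = tri 0 b c) (f : Module.End ℤ Trunc3) :
    f ∈ L.H0 ↔ ∃ a j k t : ℤ, c * (t - j) = k * (b * (b - 1)) ∧ f = lowerEnd a j k t := by
  obtain ⟨⟨u, hu⟩, hc⟩ := L.two_dvd_coeff h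
  have hc0 : c ≠ 0 := by rintro rfl; simp at hc
  constructor
  · rintro ⟨hf, hd⟩
    obtain ⟨a, j, k, s, t, h0, h1, h2⟩ := Endbar_coords hf
    have e := LinearMap.congr_fun (sub_eq_zero.1 (congrFun hd 2)) x3
    simp only [Module.End.mul_apply, adams_apply] at e
    rw [h1, show ((2 : ℕ+) : ℕ) = 2 from rfl, h, L.adamsFun_tri two_pos h, end_tri, h0, h1, h2,
      smul_tri, smul_tri, smul_tri, tri_add, tri_add, tri_inj] at e
    have hs : s = 0 := by
      have : c * s = 0 := by linear_combination -e.2.1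
      exact (mul_eq_zero.1 this).resolve_left hc0
    subst hs
    exact ⟨a, j, k, t, by linear_combination -e.2.2, eq_lowerEnd h0 h1 h2⟩
  · rintro ⟨a, j, k, t, e, rfl⟩
    refine ⟨lowerEnd_mem_Endbar ?_, funext fun m => sub_eq_zero.2 ?_⟩
    -- As `b` is even and `c` odd, the linear equation already implies the parity condition for
    -- `Endbar`.
    · have : (2 : ℤ) ∣ c * (t - j) := by
        rw [e, hu]
        exact ⟨k * (u * (u + u - 1)), by ring⟩
      exact (Int.prime_two.dvd_mul.1 this).resolve_left (by
        rw [← even_iff_two_dvd, Int.not_even_iff_odd]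
        exact hc)
    · obtain ⟨b', c', h'⟩ := L.exists_adamsFun_x3 m m.pos
      -- Proportionality of `(c', b'(b'-1))` to `(c, b(b-1))` transfers the equation from `ψ^2` to
      -- `ψ^m`.
      have e' : c' * (t - j) = k * (b' * (b' - 1)) := by
        apply mul_left_cancel₀ hc0
        have := L.coeff_relation two_pos m.pos h h'
        linear_combination c' * e - k * this
      have he : ∀ r, L.adamsFun (lowerEnd a j k t r) m = lowerEnd a j k t (L.adamsFun r m) := by
        intro r
        obtain ⟨α, β, γ, rfl⟩ := exists_tri r
        rw [lowerEnd_tri, L.adamsFun_tri m.pos h', L.adamsFun_tri m.pos h', lowerEnd_tri, tri_inj]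
        refine ⟨by ring, by ring, by linear_combination -β * e'⟩
      ext r
      exact he r

end LambdaRing

end LambdaCohomology

end

/-! ### Rank, commutativity and classification -/

noncomputable section

namespace LambdaCohomology

/-- Take `u = c/g` and `v = B/g` with `g = gcd(c, B)`. That `u ≠ 0` makes the parameter `n` unique.
-/
lemma exists_coprime_param {c B : ℤ} (hc : c ≠ 0) : ∃ u v : ℤ, u ≠ 0 ∧
    ∀ k s : ℤ, c * s = k * B ↔ ∃ n, k = u * n ∧ s = v * n := by
  have hg : ((Int.gcd c B : ℕ) : ℤ) ≠ 0 := by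
    simp [Int.gcd_eq_zero_iff, hc]
  obtain ⟨u, hu⟩ := Int.gcd_dvd_left c B
  obtain ⟨v, hv⟩ := Int.gcd_dvd_right c B
  have hu0 : u ≠ 0 := by
    rintro rfl
    exact hc (by simpa using hu)
  have hcop : IsCoprime u v := by
    refine ⟨Int.gcdA c B, Int.gcdB c B, mul_left_cancel₀ hg ?_⟩
    linear_combination -Int.gcd_eq_gcd_ab c B - Int.gcdA c B * hu - Int.gcdB c B * hv
  refine ⟨u, v, hu0, fun k s => ⟨fun h => ?_, ?_⟩⟩
  · have h1 : u * s = k * v := by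
      apply mul_left_cancel₀ hg
      linear_combination h - s * hu + k * hv
    obtain ⟨n, rfl⟩ : u ∣ k := hcop.dvd_of_dvd_mul_right ⟨s, h1.symm⟩
    refine ⟨n, rfl, mul_left_cancel₀ hu0 ?_⟩
    linear_combination h1
  · rintro ⟨n, rfl, rfl⟩
    linear_combination v * n * hu - u * n * hv

lemma familyGcd_mem {ι : Type*} (f : ι → ℤ) : (familyGcd f : ℤ) ∈ Ideal.span (Set.range f) := by
  have h := Submodule.IsPrincipal.generator_mem (Ideal.span (Set.range f))
  rw [familyGcd]
  rcases Int.natAbs_eq (Submodule.IsPrincipal.generator (Ideal.span (Set.range f))) with e | e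
  · rwa [← e]
  · rw [← neg_mem_iff, ← e]
    exact h

/-- The linear family `lowerEnd a j (u n) (j + v n)`. -/
def lowerFamily (u v : ℤ) : (Fin 3 → ℤ) →ₗ[ℤ] Module.End ℤ Trunc3 :=
  toMat.symm.toLinearMap ∘ₗ
    { toFun := fun w => !![w 0, 0, 0; 0, w 1, 0; 0, u * w 2, w 1 + v * w 2]
      map_add' := fun w w' => by
        ext i j
        fin_cases i <;> fin_cases j <;> simp <;> ring
      map_smul' := fun n w => by
        ext i j
        fin_cases i <;> fin_cases j <;> simp <;> ring }

lemma lowerFamily_apply (u v : ℤ) (w : Fin 3 → ℤ) :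
    lowerFamily u v w = lowerEnd (w 0) (w 1) (u * w 2) (w 1 + v * w 2) := rfl

lemma lowerFamily_injective {u : ℤ} (hu : u ≠ 0) (v : ℤ) :
    Function.Injective (lowerFamily u v) := by
  intro w w' h
  rw [lowerFamily_apply, lowerFamily_apply] at h
  obtain ⟨h0, h1, h2, -⟩ := lowerEnd_inj h
  have h2' := mul_left_cancel₀ hu h2
  funext i
  fin_cases i
  exacts [h0, h1, h2']

namespace LambdaRing

variable (L : LambdaRing Trunc3)

lemma exists_lowerFamily : ∃ u v : ℤ, u ≠ 0 ∧
    Subalgebra.toSubmodule L.H0 = LinearMap.range (lowerFamily u v) := by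
  obtain ⟨b, c, h⟩ := L.exists_adamsFun_x3 2 two_pos
  have hc : c ≠ 0 := by
    rintro rfl
    simpa using (L.two_dvd_coeff h).2
  obtain ⟨u, v, hu, huv⟩ := exists_coprime_param (B := b * (b - 1)) hc
  refine ⟨u, v, hu, ?_⟩
  ext f
  rw [Subalgebra.mem_toSubmodule, L.mem_H0_iff h, LinearMap.mem_range]
  constructor
  · rintro ⟨a, j, k, t, e, rfl⟩
    obtain ⟨n, rfl, e⟩ := (huv _ _).1 e
    refine ⟨![a, j, n], ?_⟩
    obtain rfl : t = j + v * n := by linarith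
    rfl
  · rintro ⟨w, rfl⟩
    exact ⟨_, _, _, _, (huv _ _).2 ⟨w 2, rfl, by ring⟩, lowerFamily_apply u v w⟩

/-- The only off-diagonal entry of a product is `u(n j' + j n' + v n n')`, symmetric in the two
factors. -/
lemma H0_comm {f g : Module.End ℤ Trunc3} (hf : f ∈ L.H0) (hg : g ∈ L.H0) : f * g = g * f := by
  obtain ⟨u, v, -, e⟩ := L.exists_lowerFamily
  rw [← Subalgebra.mem_toSubmodule, e] at hf hg
  obtain ⟨w, rfl⟩ := hf
  obtain ⟨w', rfl⟩ := hg
  rw [lowerFamily_apply, lowerFamily_apply, lowerEnd_mul, lowerEnd_mul]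
  congr 1 <;> ring

lemma nonempty_linearEquiv_H0 : Nonempty ((Fin 3 → ℤ) ≃ₗ[ℤ] L.H0) := by
  obtain ⟨u, v, hu, e⟩ := L.exists_lowerFamily
  exact ⟨(LinearEquiv.ofInjective _ (lowerFamily_injective hu v)).trans
    (LinearEquiv.ofEq _ _ e.symm)⟩

lemma mem_H0Mat_iff {b c : ℤ} (h : L.adamsFun x3 2 = tri 0 b c) (M : Matrix (Fin 3) (Fin 3) ℤ) :
    M ∈ H0Mat L ↔
      ∃ a j k t : ℤ, c * (t - j) = k * (b * (b - 1)) ∧ M = !![a, 0, 0; 0, j, 0; 0, k, t] := by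
  rw [H0Mat, Subalgebra.mem_map]
  constructor
  · rintro ⟨f, hf, rfl⟩
    obtain ⟨a, j, k, t, e, rfl⟩ := (L.mem_H0_iff h f).1 hf
    exact ⟨a, j, k, t, e, toMat_lowerEnd a j k t⟩
  · rintro ⟨a, j, k, t, e, rfl⟩
    exact ⟨_, (L.mem_H0_iff h _).2 ⟨a, j, k, t, e, rfl⟩, toMat_lowerEnd a j k t⟩

lemma classification : (∃ c : Nat.Primes → ℤ, IsSc L c) ∨
    ∃ (b : Nat.Primes → ℤ) (h : ℤ), Odd h ∧ IsSbh L b h := by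
  choose b c hbc using fun p : Nat.Primes => L.exists_adamsFun_x3 p p.2.pos
  let q : Nat.Primes := ⟨2, Nat.prime_two⟩
  obtain ⟨hb2, hc2⟩ := L.two_dvd_coeff (hbc q)
  have hc0 : c q ≠ 0 := by
    intro h
    simp [h] at hc2
  have hrel : ∀ p, c q * (b p * (b p - 1)) = c p * (b q * (b q - 1)) := fun p =>
    L.coeff_relation q.2.pos p.2.pos (hbc q) (hbc p)
  by_cases hq : b q = 0
  · refine Or.inl ⟨c, fun p => ?_⟩
    have h1 : b p * (b p - 1) = 0 := by
      have h := hrel p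
      rw [hq, zero_mul, mul_zero] at h
      exact (mul_eq_zero.1 h).resolve_left hc0
    have h2 : b p = 0 := by
      -- `b_p = 1` is impossible because `ψ^p(x) ≡ x^p` mod `p` gives `p ∣ b_p`.
      refine (mul_eq_zero.1 h1).resolve_right fun h2 => ?_
      have h3 := L.prime_dvd_coeff p.2 (hbc p)
      rw [sub_eq_zero.1 h2] at h3
      exact p.2.one_lt.ne' (by exact_mod_cast Int.eq_one_of_dvd_one (by positivity) h3)
    have h3 := hbc p
    rw [h2] at h3
    refine Eq.trans h3 ?_
    simp [tri]
  · have hB : b q * (b q - 1) ≠ 0 := by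
      refine mul_ne_zero hq fun h => ?_
      rw [sub_eq_zero.1 h] at hb2
      exact absurd hb2 (by decide)
    have hdvd : ∀ p, (gcdG b : ℤ) ∣ b p * (b p - 1) := (dvd_familyGcd_iff _ _).1 dvd_rfl
    have hG : (gcdG b : ℤ) ≠ 0 := fun h => hB (by simpa [h] using hdvd q)
    -- `G` is an integral combination of the `b_p(b_p-1)`, so `h = c_2 G / (b_2(b_2-1))` is an
    -- integer; it is odd because it divides `c_2`.
    have hspan : ∀ z ∈ Ideal.span (Set.range fun p => b p * (b p - 1)),
        b q * (b q - 1) ∣ c q * z := by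
      intro z hz
      induction hz using Submodule.span_induction with
      | mem z hz =>
        obtain ⟨p, rfl⟩ := hz
        exact ⟨c p, by rw [hrel p, mul_comm]⟩
      | zero => simp
      | add y z _ _ hy hz =>
        rw [mul_add]
        exact dvd_add hy hz
      | smul a z _ hz =>
        rw [smul_eq_mul, mul_left_comm]
        exact Dvd.dvd.mul_left hz a
    obtain ⟨h, hh⟩ := hspan _ (familyGcd_mem fun p => b p * (b p - 1))
    have hc : ∀ p, c p = h * (b p * (b p - 1) / (gcdG b : ℤ)) := by
      intro p
      obtain ⟨m, hm⟩ := hdvd p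
      rw [hm, Int.mul_ediv_cancel_left _ hG]
      apply mul_left_cancel₀ hB
      have hh' : c q * (gcdG b : ℤ) = b q * (b q - 1) * h := hh
      linear_combination m * hh' - hrel p + c q * hm
    refine Or.inr ⟨b, h, ?_, hq, fun p => ?_⟩
    · rw [hc q] at hc2
      exact Int.Odd.of_mul_left hc2
    · rw [← hc p]
      refine Eq.trans (hbc p) ?_
      simp [tri]

end LambdaRing

end LambdaCohomology

end

/-! ### The two matrix descriptions -/

theorem theorem4p1 (R : LambdaCohomology.FilteredLambdaRing LambdaCohomology.Trunc3)
    (d : ℕ) (hd : 0 < d) (hx : LambdaCohomology.x3 ∈ R.I d) :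
    ((∃ c : Nat.Primes → ℤ, LambdaCohomology.IsSc R.toLambdaRing c) ∨
      (∃ (b : Nat.Primes → ℤ) (h : ℤ), Odd h ∧ LambdaCohomology.IsSbh R.toLambdaRing b h)) ∧
    (∀ c : Nat.Primes → ℤ, LambdaCohomology.IsSc R.toLambdaRing c →
      (LambdaCohomology.H0Mat R.toLambdaRing : Set (Matrix (Fin 3) (Fin 3) ℤ)) =
        {M | ∃ a j k : ℤ, M = !![a, 0, 0; 0, j, 0; 0, k, j]}) ∧
    (∀ (b : Nat.Primes → ℤ) (h : ℤ), LambdaCohomology.IsSbh R.toLambdaRing b h →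
      (LambdaCohomology.H0Mat R.toLambdaRing : Set (Matrix (Fin 3) (Fin 3) ℤ)) =
        {M | ∃ a j k t : ℤ, h * (t - j) = k * (LambdaCohomology.gcdG b : ℤ) ∧
          M = !![a, 0, 0; 0, j, 0; 0, k, t]}) ∧
    (∀ f ∈ R.toLambdaRing.H0, ∀ g ∈ R.toLambdaRing.H0, f * g = g * f) ∧
    Module.Free ℤ R.toLambdaRing.H0 ∧
    Module.finrank ℤ R.toLambdaRing.H0 = 3 := by
  obtain ⟨e⟩ := R.toLambdaRing.nonempty_linearEquiv_H0
  refine ⟨R.toLambdaRing.classification, fun c hc => ?_, fun b h hb => ?_,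
    fun f hf g hg => R.toLambdaRing.H0_comm hf hg, Module.Free.of_equiv e, ?_⟩
  · have h2 : R.toLambdaRing.adamsFun LambdaCohomology.x3 2 =
        LambdaCohomology.tri 0 0 (c ⟨2, Nat.prime_two⟩) :=
      (hc ⟨2, Nat.prime_two⟩).trans (by simp [LambdaCohomology.tri])
    have hodd := (R.toLambdaRing.two_dvd_coeff h2).2
    ext M
    rw [SetLike.mem_coe, R.toLambdaRing.mem_H0Mat_iff h2]
    constructor
    · rintro ⟨a, j, k, t, e, rfl⟩
      have ht : t - j = 0 := by
        rw [zero_mul, mul_zero] at e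
        refine (mul_eq_zero.1 e).resolve_left fun h => ?_
        simp [h] at hodd
      exact ⟨a, j, k, by rw [sub_eq_zero.1 ht]⟩
    · rintro ⟨a, j, k, rfl⟩
      exact ⟨a, j, k, j, by simp, rfl⟩
  -- With `b_2(b_2-1) = Gm` one has `c_2 = hm`, so the equation for `ψ^2` is `m` times the asserted
  -- one.
  · obtain ⟨m, hm⟩ := (LambdaCohomology.dvd_familyGcd_iff
      (fun p => b p * (b p - 1)) (LambdaCohomology.gcdG b : ℤ)).1 dvd_rfl ⟨2, Nat.prime_two⟩
    have hb2 := hb.2 ⟨2, Nat.prime_two⟩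
    have h2 : R.toLambdaRing.adamsFun LambdaCohomology.x3 2 =
        LambdaCohomology.tri 0 (b ⟨2, Nat.prime_two⟩)
          (h * (b ⟨2, Nat.prime_two⟩ * (b ⟨2, Nat.prime_two⟩ - 1) / (LambdaCohomology.gcdG b : ℤ))) :=
      hb2.trans (by simp [LambdaCohomology.tri])
    have hodd := (R.toLambdaRing.two_dvd_coeff h2).2
    -- If `G = 0`, integer division by zero would give `c_2 = 0`, which is not odd.
    have hG : (LambdaCohomology.gcdG b : ℤ) ≠ 0 := by
      intro h0
      simp [h0] at hodd
    rw [hm, Int.mul_ediv_cancel_left _ hG] at h2 hodd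
    have hm0 : m ≠ 0 := by
      rintro rfl
      simp at hodd
    ext M
    rw [SetLike.mem_coe, R.toLambdaRing.mem_H0Mat_iff h2]
    refine exists_congr fun a => exists_congr fun j => exists_congr fun k => exists_congr fun t =>
      and_congr_left fun _ => ?_
    rw [hm]
    constructor
    · intro e
      apply mul_left_cancel₀ hm0
      linear_combination e
    · intro e
      linear_combination m * e
  · rw [← e.finrank_eq]
    simp
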